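/- Let $K$ be a field. For a finite quiver $Q$ write $ab$ for the path $a$ followed by $b$. Call $A = KQ/I$ an \emph{almost gentle algebra} if $I$ is an admissible ideal of the path algebra $KQ$ (i.e. $R^m \subseteq I \subseteq R^2$ for some $m \ge 2$, where $R$ is the ideal generated by the arrows), $I$ is generated by paths of length $2$, and for every arrow $a$ there is at most one arrow $b$ with $ab \notin I$ and at most one arrow $c$ with $ca \notin I$. A \emph{maximal path} of $A$ is a path $p \notin I$ with $ap \in I$ and $pa \in I$ for all arrows $a$. Let $\overline{\mathcal M}$ be the set of the maximal paths together with the trivial paths $e_v$ for those vertices $v$ that satisfy one of: (1) $v$ is the source of exactly one arrow and the target of none; (2) $v$ is the target of exactly one arrow and the source of none; (3) $v$ is the target of exactly one arrow $a$ and the source of exactly one arrow $b$, and $ab \notin I$. A \emph{hypergraph with orientation} consists of finitely many vertices, a finite family of hyperedges, each a multiset of vertices, and, for every vertex $x$, a cyclic ordering of the hyperedges containing $x$, each listed as often as it contains $x$. The hypergraph with orientation $\mathcal H_A$ has vertex set $\overline{\mathcal M}$ and one hyperedge $E_v$ for each vertex $v$ of $Q$; $E_v$ contains $p \in \overline{\mathcal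 M}$ as often as $v$ occurs on $p$ (endpoints included). If $p \in \overline{\mathcal M}$ runs successively through $v_1, v_2, \dots, v_n$, then the cyclic ordering at $p$ is $E_{v_1} < E_{v_2} < \cdots < E_{v_n} < E_{v_1}$. For a finite-dimensional $K$-algebra $A$ with dual bimodule $D(A) = \operatorname{Hom}_K(A,K)$, $(afb)(x) = f(bxa)$, let $T(A) = A \ltimes D(A)$ be its trivial extension, that is $A \oplus D(A)$ with multiplication $(a,f)(b,g) = (ab, ag+fb)$. \textbf{Theorem.} Let $A = KQ/I$ and $B = KQ'/I'$ be almost gentle algebras over $K$. Then $\mathcal H_A$ and $\mathcal H_B$ are isomorphic as hypergraphs with orientation (by bijections on vertices and on hyperedges that respect the multisets and the cyclic orderings) if and only if $T(A)$ and $T(B)$ are isomorphic as $K$-algebras. -/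

import Mathlib

noncomputable section

namespace AlmostGentle

universe u₁ u₂ u₃ u₄

/-! ### The path algebra of a finite quiver -/

/-- A path in a quiver, together with its source and its target. -/
abbrev QPath (V : Type*) [Quiver V] : Type _ := Σ u v : V, Quiver.Path u v

namespace QPath

variable {V : Type*} [Quiver V]

/-- The source of a path. -/
abbrev src (p : QPath V) : V := p.1

/-- The target of a path. -/
abbrev tgt (p : QPath V) : V := p.2.1

/-- The length of a path. -/
abbrev len (p : QPath V) : ℕ := p.2.2.length

/-- The list of the vertices through which a path runs, in order, endpoints included. -/
abbrev verts (p : QPath V) : List V := p.2.2.vertices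

/-- The trivial path `e_v`. -/
def triv (v : V) : QPath V := ⟨v, v, Quiver.Path.nil⟩

/-- An arrow as a path of length one. -/
def arrow {u v : V} (a : u ⟶ v) : QPath V := ⟨u, v, a.toPath⟩

/-- The concatenation `p q`, that is `p` followed by `q`, of composable paths. -/
def comp (p q : QPath V) (h : p.tgt = q.src) : QPath V :=
  ⟨p.src, q.tgt, p.2.2.comp (q.2.2.cast h.symm rfl)⟩

theorem triv_comp (p : QPath V) (v : V) (h : v = p.src) : (triv v).comp p h = p := by
  obtain ⟨a, b, p⟩ := p
  change v = a at h
  cases h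
  simp [comp, triv]

theorem comp_triv (p : QPath V) (v : V) (h : p.tgt = v) : p.comp (triv v) h = p := by
  obtain ⟨a, b, p⟩ := p
  change b = v at h
  cases h
  simp [comp, triv]

theorem comp_assoc (p q r : QPath V) (h : p.tgt = q.src) (h' : q.tgt = r.src) :
    (p.comp q h).comp r h' = p.comp (q.comp r h') h := by
  obtain ⟨a, b, p⟩ := p
  obtain ⟨c, d, q⟩ := q
  obtain ⟨e, f, r⟩ := r
  dsimp only [src, tgt] at h h'
  subst h
  subst h'
  simp [comp]

end QPath

/-- The path algebra `K V` of a quiver: the vector space on all paths. -/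
def PathAlgebra (K V : Type*) [Field K] [Quiver V] : Type _ := QPath V →₀ K

namespace PathAlgebra

variable {K V : Type*} [Field K] [Quiver V]

instance : AddCommGroup (PathAlgebra K V) := inferInstanceAs (AddCommGroup (QPath V →₀ K))

instance : Module K (PathAlgebra K V) := inferInstanceAs (Module K (QPath V →₀ K))

/-- The coefficient of a path in an element of the path algebra. -/
def coeff (x : PathAlgebra K V) (p : QPath V) : K :=
  (show QPath V →₀ K from x) p

variable (K) in
/-- A path as an element of the path algebra. -/
def of (p : QPath V) : PathAlgebra K V := Finsupp.single p (1 : K)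

open Classical in
variable (K) in
/-- The product of two paths: their concatenation if they are composable, and zero otherwise. -/
def mulPath (p q : QPath V) : PathAlgebra K V :=
  if h : p.tgt = q.src then of K (p.comp q h) else 0

variable (K V) in
/-- The bilinear extension of the product of paths. -/
def mulHom : PathAlgebra K V →ₗ[K] PathAlgebra K V →ₗ[K] PathAlgebra K V :=
  Finsupp.linearCombination K (M := (QPath V →₀ K) →ₗ[K] PathAlgebra K V)
    fun p => Finsupp.linearCombination K (mulPath K p)

instance : Mul (PathAlgebra K V) := ⟨fun x y => mulHom K V x y⟩

instance [Fintype V] : One (PathAlgebra K V) := ⟨∑ v : V, of K (QPath.triv v)⟩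

theorem mul_def (x y : PathAlgebra K V) : x * y = mulHom K V x y := rfl

theorem one_def [Fintype V] : (1 : PathAlgebra K V) = ∑ v : V, of K (QPath.triv v) := rfl

theorem of_mul_of (p q : QPath V) : of K p * of K q = mulPath K p q := by
  rw [mul_def, mulHom, of, of]
  erw [Finsupp.linearCombination_single, one_smul, Finsupp.linearCombination_single, one_smul]

theorem induction {P : PathAlgebra K V → Prop} (x : PathAlgebra K V) (h0 : P 0)
    (ha : ∀ x y, P x → P y → P (x + y)) (hs : ∀ (c : K) (p : QPath V), P (c • of K p)) : P x := by
  refine Finsupp.induction_linear (motive := P) x h0 ha fun p c => ?_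
  have := hs c p
  rw [of] at this
  erw [Finsupp.smul_single, smul_eq_mul, mul_one] at this
  exact this

theorem mulPath_of_eq (p q : QPath V) (h : p.tgt = q.src) :
    mulPath K p q = of K (p.comp q h) := dif_pos h

theorem mulPath_of_ne (p q : QPath V) (h : p.tgt ≠ q.src) : mulPath K p q = 0 := dif_neg h

theorem mulPath_mul_of (p q r : QPath V) :
    mulPath K p q * of K r = of K p * mulPath K q r := by
  by_cases h : p.tgt = q.src <;> by_cases h' : q.tgt = r.src
  · rw [mulPath_of_eq p q h, mulPath_of_eq q r h', of_mul_of, of_mul_of,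
      mulPath_of_eq (p.comp q h) r h', mulPath_of_eq p (q.comp r h') h, QPath.comp_assoc]
  · rw [mulPath_of_eq p q h, mulPath_of_ne q r h', of_mul_of, mulPath_of_ne (p.comp q h) r h']
    simp [mul_def]
  · rw [mulPath_of_ne p q h, mulPath_of_eq q r h', of_mul_of, mulPath_of_ne p (q.comp r h') h]
    simp [mul_def]
  · rw [mulPath_of_ne p q h, mulPath_of_ne q r h']
    simp [mul_def]

theorem one_mul_of [Fintype V] (p : QPath V) : 1 * of K p = of K p := by
  have h : ∀ v : V, v ≠ p.src → mulHom K V (of K (QPath.triv v)) (of K p) = 0 :=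
    fun v hv => by rw [← mul_def, of_mul_of]; exact mulPath_of_ne _ _ hv
  rw [mul_def, one_def, map_sum, LinearMap.sum_apply,
    Finset.sum_eq_single p.src (fun v _ => h v) (by simp), ← mul_def, of_mul_of,
    mulPath_of_eq (QPath.triv p.src) p rfl]
  exact congrArg (of K) (QPath.triv_comp p p.src rfl)

theorem of_mul_one [Fintype V] (p : QPath V) : of K p * 1 = of K p := by
  have h : ∀ v : V, v ≠ p.tgt → mulHom K V (of K p) (of K (QPath.triv v)) = 0 :=
    fun v hv => by rw [← mul_def, of_mul_of]; exact mulPath_of_ne _ _ hv.symm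
  rw [mul_def, one_def, map_sum,
    Finset.sum_eq_single p.tgt (fun v _ => h v) (by simp), ← mul_def, of_mul_of,
    mulPath_of_eq p (QPath.triv p.tgt) rfl, QPath.comp_triv]

instance [Fintype V] : Ring (PathAlgebra K V) :=
  { (inferInstance : AddCommGroup (PathAlgebra K V)) with
    mul := (· * ·)
    one := 1
    left_distrib := fun x y z => by simp only [mul_def, map_add]
    right_distrib := fun x y z => by simp only [mul_def, map_add, LinearMap.add_apply]
    zero_mul := fun x => by simp only [mul_def, map_zero, LinearMap.zero_apply]
    mul_zero := fun x => by simp only [mul_def, map_zero]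
    mul_assoc := fun x y z => by
      refine induction (P := fun x => x * y * z = x * (y * z)) x (by simp [mul_def])
        (fun x x' h h' => ?_) fun a p => ?_
      · simp only [mul_def, map_add, LinearMap.add_apply] at *; rw [h, h']
      refine induction (P := fun y => a • of K p * y * z = a • of K p * (y * z)) y
        (by simp [mul_def]) (fun x x' h h' => ?_) fun b q => ?_
      · simp only [mul_def, map_add, LinearMap.add_apply] at *; rw [h, h']
      refine induction (P := fun z => a • of K p * (b • of K q) * z =
        a • of K p * (b • of K q * z)) z (by simp [mul_def]) (fun x x' h h' => ?_) fun c r => ?_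
      · simp only [mul_def, map_add] at *; rw [h, h']
      have := mulPath_mul_of (K := K) p q r
      rw [← of_mul_of, ← of_mul_of] at this
      simp only [mul_def, map_smul, LinearMap.smul_apply] at *
      rw [this]
    one_mul := fun x => by
      refine induction (P := fun x => 1 * x = x) x (by simp [mul_def])
        (fun x x' h h' => ?_) fun a p => ?_
      · simp only [mul_def, map_add] at *; rw [h, h']
      · have key := one_mul_of (K := K) p
        simp only [mul_def, map_smul] at *
        rw [key]
    mul_one := fun x => by
      refine induction (P := fun x => x * 1 = x) x (by simp [mul_def])
        (fun x x' h h' => ?_) fun a p => ?_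
      · simp only [mul_def, map_add, LinearMap.add_apply] at *; rw [h, h']
      · have key := of_mul_one (K := K) p
        simp only [mul_def, map_smul, LinearMap.smul_apply] at *
        rw [key]
    zsmul := fun n x => n • x
    zsmul_zero' := fun x => zero_zsmul x
    zsmul_succ' := fun n x => SubNegMonoid.zsmul_succ' n x
    zsmul_neg' := fun n x => SubNegMonoid.zsmul_neg' n x
    nsmul := fun n x => n • x
    nsmul_zero := fun x => zero_nsmul x
    nsmul_succ := fun n x => succ_nsmul x n }

instance [Fintype V] : Algebra K (PathAlgebra K V) :=
  Algebra.ofModule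
    (fun c x y => by simp only [mul_def, map_smul, LinearMap.smul_apply])
    (fun c x y => by simp only [mul_def, map_smul])

end PathAlgebra

/-! ### The trivial extension of an algebra -/

/-- The `K`-linear dual `D(A) = Hom_K(A, K)`, as an `A`-`A`-bimodule. -/
def DualBimodule (K A : Type*) [Field K] [Ring A] [Algebra K A] : Type _ := A →ₗ[K] K

namespace DualBimodule

variable {K A : Type*} [Field K] [Ring A] [Algebra K A]

instance : AddCommGroup (DualBimodule K A) := inferInstanceAs (AddCommGroup (A →ₗ[K] K))

instance : Module K (DualBimodule K A) := inferInstanceAs (Module K (A →ₗ[K] K))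

instance : FunLike (DualBimodule K A) A K := inferInstanceAs (FunLike (A →ₗ[K] K) A K)

instance : LinearMapClass (DualBimodule K A) K A K :=
  inferInstanceAs (LinearMapClass (A →ₗ[K] K) K A K)

@[ext] theorem ext {f g : DualBimodule K A} (h : ∀ x, f x = g x) : f = g := LinearMap.ext h

@[simp] theorem add_apply (f g : DualBimodule K A) (x : A) : (f + g) x = f x + g x := rfl

@[simp] theorem zero_apply (x : A) : (0 : DualBimodule K A) x = 0 := rfl

@[simp] theorem smul_apply (c : K) (f : DualBimodule K A) (x : A) : (c • f) x = c * f x := rfl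

/-- The left action, `(a f)(x) = f(x a)`. -/
instance : SMul A (DualBimodule K A) := ⟨fun a f => LinearMap.comp f (LinearMap.mulRight K a)⟩

/-- The right action, `(f b)(x) = f(b x)`. -/
instance : SMul Aᵐᵒᵖ (DualBimodule K A) :=
  ⟨fun b f => LinearMap.comp f (LinearMap.mulLeft K b.unop)⟩

@[simp] theorem left_apply (a : A) (f : DualBimodule K A) (x : A) : (a • f) x = f (x * a) := rfl

@[simp] theorem right_apply (b : Aᵐᵒᵖ) (f : DualBimodule K A) (x : A) :
    (b • f) x = f (b.unop * x) := rfl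

instance : Module A (DualBimodule K A) where
  one_smul f := by ext x; simp
  mul_smul a b f := by ext x; simp [mul_assoc]
  smul_zero a := by ext x; simp
  smul_add a f g := by ext x; simp
  add_smul a b f := by ext x; simp [mul_add]
  zero_smul f := by ext x; simp

instance : Module Aᵐᵒᵖ (DualBimodule K A) where
  one_smul f := by ext x; simp
  mul_smul a b f := by ext x; simp [mul_assoc]
  smul_zero a := by ext x; simp
  smul_add a f g := by ext x; simp
  add_smul a b f := by ext x; simp [add_mul]
  zero_smul f := by ext x; simp

instance : SMulCommClass A Aᵐᵒᵖ (DualBimodule K A) where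
  smul_comm a b f := by ext x; simp [mul_assoc]

instance : IsScalarTower K A (DualBimodule K A) where
  smul_assoc c a f := by ext x; simp

instance : IsScalarTower K Aᵐᵒᵖ (DualBimodule K A) where
  smul_assoc c a f := by ext x; simp

end DualBimodule

/-- The trivial extension `T(A)`: the space `A ⊕ D(A)` with the multiplication
`(a, f) (b, g) = (a b, a g + f b)`. -/
abbrev TrivialExtension (K A : Type*) [Field K] [Ring A] [Algebra K A] : Type _ :=
  TrivSqZeroExt A (DualBimodule K A)

/-! ### Almost gentle algebras -/

section AlmostGentle

variable {K V : Type*} [Field K] [Quiver V] [Fintype V]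

/-- The quotient algebra `K V / I`. -/
abbrev QuotientAlgebra (I : TwoSidedIdeal (PathAlgebra K V)) : Type _ := I.ringCon.Quotient

/-- The ideal `I` is admissible: `R ^ m ≤ I ≤ R ^ 2` for some `m ≥ 2`, where `R` is the ideal
generated by the arrows, so that `R ^ m` is spanned by the paths of length at least `m`. -/
def IsAdmissible (I : TwoSidedIdeal (PathAlgebra K V)) : Prop :=
  (∃ m : ℕ, 2 ≤ m ∧ ∀ p : QPath V, m ≤ p.len → PathAlgebra.of K p ∈ I) ∧
    ∀ x ∈ I, ∀ p : QPath V, p.len < 2 → PathAlgebra.coeff x p = 0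

/-- The composable pair of arrows `a`, `b` as a path of length two. -/
abbrev arrowPair {u v w : V} (a : u ⟶ v) (b : v ⟶ w) : QPath V :=
  (QPath.arrow a).comp (QPath.arrow b) rfl

/-- The pair of a quiver and an ideal `I` of its path algebra is a presentation of the almost
gentle algebra `K V / I`. -/
structure IsAlmostGentle (I : TwoSidedIdeal (PathAlgebra K V)) : Prop where
  admissible : IsAdmissible I
  /-- `I` is generated by paths of length two. -/
  generated : ∃ S : Set (QPath V), (∀ p ∈ S, p.len = 2) ∧
    I = TwoSidedIdeal.span (PathAlgebra.of K '' S)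
  /-- For an arrow `a` there is at most one arrow `b` with `a b ∉ I`. -/
  right_unique : ∀ {u v : V} (a : u ⟶ v) (b b' : Σ w : V, v ⟶ w),
    PathAlgebra.of K (arrowPair a b.2) ∉ I → PathAlgebra.of K (arrowPair a b'.2) ∉ I → b = b'
  /-- For an arrow `a` there is at most one arrow `c` with `c a ∉ I`. -/
  left_unique : ∀ {u v : V} (a : u ⟶ v) (c c' : Σ w : V, w ⟶ u),
    PathAlgebra.of K (arrowPair c.2 a) ∉ I → PathAlgebra.of K (arrowPair c'.2 a) ∉ I → c = c'

/-- A maximal path of `K V / I`: a path `p ∉ I` such that `a p ∈ I` and `p a ∈ I` for all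
arrows `a` (when `a` and `p` are not composable, the product is zero). -/
def IsMaximalPath (I : TwoSidedIdeal (PathAlgebra K V)) (p : QPath V) : Prop :=
  PathAlgebra.of K p ∉ I ∧
    (∀ (u v : V) (a : u ⟶ v), PathAlgebra.of K (QPath.arrow a) * PathAlgebra.of K p ∈ I) ∧
    ∀ (u v : V) (a : u ⟶ v), PathAlgebra.of K p * PathAlgebra.of K (QPath.arrow a) ∈ I

/-- The vertices whose trivial path is added to the maximal paths: those that are
* the source of exactly one arrow and the target of none, or
* the target of exactly one arrow and the source of none, or
* the target of exactly one arrow `a` and the source of exactly one arrow `b`, with `a b ∉ I`. -/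
def IsTruncated (I : TwoSidedIdeal (PathAlgebra K V)) (v : V) : Prop :=
  ((∃ b : Σ w : V, v ⟶ w, ∀ b', b' = b) ∧ IsEmpty (Σ u : V, u ⟶ v)) ∨
  ((∃ a : Σ u : V, u ⟶ v, ∀ a', a' = a) ∧ IsEmpty (Σ w : V, v ⟶ w)) ∨
  ∃ (a : Σ u : V, u ⟶ v) (b : Σ w : V, v ⟶ w), (∀ a', a' = a) ∧ (∀ b', b' = b) ∧
    PathAlgebra.of K (arrowPair a.2 b.2) ∉ I

/-- The maximal paths together with the added trivial paths. -/
def ExtendedPaths (I : TwoSidedIdeal (PathAlgebra K V)) : Type _ :=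
  {p : QPath V // IsMaximalPath I p ∨ ∃ v : V, IsTruncated I v ∧ p = QPath.triv v}

end AlmostGentle

/-! ### Oriented hypergraphs -/

open Classical in
/-- A hypergraph with orientation: finitely many vertices, finitely many hyperedges, each with
a multiset of vertices, and for every vertex `x` a cyclic ordering of the hyperedges containing
`x`, in which each hyperedge occurs as often as it contains `x`. -/
structure OrientedHypergraph : Type (max (u₁ + 1) (u₂ + 1)) where
  Vert : Type u₁
  Edge : Type u₂
  finite_vert : Finite Vert
  finite_edge : Finite Edge
  edge : Edge → Multiset Vert
  order : Vert → Cycle Edge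
  count_order : ∀ (x : Vert) (e : Edge), (order x).toMultiset.count e = (edge e).count x

/-- An isomorphism of hypergraphs with orientation: bijections on vertices and on hyperedges
which respect the multisets of vertices and the cyclic orderings. -/
structure OrientedHypergraph.Iso (G : OrientedHypergraph.{u₁, u₂})
    (H : OrientedHypergraph.{u₃, u₄}) where
  vert : G.Vert ≃ H.Vert
  edge : G.Edge ≃ H.Edge
  map_edge : ∀ e, (G.edge e).map vert = H.edge (edge e)
  map_order : ∀ x, (G.order x).map edge = H.order (vert x)

/-! ### The oriented hypergraph of an almost gentle algebra -/

theorem finite_paths_le {V : Type*} [Quiver V] [Finite V] [∀ u v : V, Finite (u ⟶ v)] (n : ℕ) :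
    {p : QPath V | p.len ≤ n}.Finite := by
  induction n with
  | zero =>
    refine (Set.finite_range (QPath.triv (V := V))).subset ?_
    rintro ⟨u, v, p⟩ hp
    cases p with
    | nil => exact ⟨u, rfl⟩
    | cons p e => simp [QPath.len] at hp
  | succ n ih =>
    have := ih.to_subtype
    let f : (Σ p : {p : QPath V | p.len ≤ n}, Σ w : V, (p.1.tgt ⟶ w)) → QPath V :=
      fun x => ⟨x.1.1.1, x.2.1, x.1.1.2.2.cons x.2.2⟩
    refine ((Set.finite_range (QPath.triv (V := V))).union (Set.finite_range f)).subset ?_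
    rintro ⟨u, v, p⟩ hp
    cases p with
    | nil => exact Or.inl ⟨u, rfl⟩
    | @cons w _ p e =>
      have hp' : p.length ≤ n := by simpa [QPath.len] using hp
      exact Or.inr ⟨⟨⟨⟨u, w, p⟩, hp'⟩, v, e⟩, rfl⟩

theorem IsAlmostGentle.finite {K V : Type*} [Field K] [Quiver V] [Fintype V]
    [∀ u v : V, Finite (u ⟶ v)] {I : TwoSidedIdeal (PathAlgebra K V)} (hI : IsAlmostGentle I) :
    Finite (ExtendedPaths I) := by
  obtain ⟨m, -, hm⟩ := hI.admissible.1
  refine Set.Finite.subset (finite_paths_le m) (s := {p : QPath V | p.len ≤ m}) ?_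
  rintro p (hp | ⟨v, -, rfl⟩)
  · by_contra h
    exact hp.1 (hm p (not_le.1 h).le)
  · exact Nat.zero_le m

open Classical in
/-- The oriented hypergraph of the almost gentle algebra `K V / I`. Its vertices are the maximal
paths together with the added trivial paths, and its hyperedges are indexed by the vertices of the
quiver: the hyperedge of `v` contains `p` as often as `v` occurs on `p`. The cyclic ordering at `p`
lists the vertices of the quiver in the order in which they occur on `p`. -/
def hypergraph {K V : Type*} [Field K] [Quiver V] [Fintype V]
    [∀ u v : V, Finite (u ⟶ v)] {I : TwoSidedIdeal (PathAlgebra K V)} (hI : IsAlmostGentle I) :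
    OrientedHypergraph where
  Vert := ExtendedPaths I
  Edge := V
  finite_vert := hI.finite
  finite_edge := inferInstance
  edge v :=
    letI : Fintype (ExtendedPaths I) := @Fintype.ofFinite _ hI.finite
    ∑ p : ExtendedPaths I, Multiset.replicate (p.1.verts.count v) p
  order p := (p.1.verts : Cycle V)
  count_order p v := by
    rw [Multiset.count_sum']
    simp only [Multiset.count_replicate, Cycle.coe_toMultiset, Multiset.coe_count]
    simp

end AlmostGentle

end

noncomputable section

namespace AlmostGentle

open Module

universe u₁ u₂ u₃ u₄

/-! ### Counting in families of cyclic words -/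

/-! Both sides of the equivalence are read off one model of `T(A)`. In an almost gentle algebra
every arrow has at most one nonzero continuation on either side, so it lies on exactly one maximal
path, in one place (`IsAlmostGentle.eq_of_getElem?`), and so does every nonzero path of positive
length. Close the word of vertices of each extended path to a cycle; the step from the last vertex
back to the first is the functional dual to the whole path. Then `T(A)` has a basis formed by the
idempotents `e_v`, their dual functionals, and the arcs on the cycles that are shorter than a full
turn: an arc that stays inside the path is a subpath, an arc that crosses the closing step is the
functional dual to the complementary subpath. Arcs multiply by concatenation on the same cycle, all
other products of arcs vanish, and a full turn from any occurrence of `v` is the functional dual to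
`e_v`. This is `ArcBasis`, constructed in `IsAlmostGentle.arcBasis`.

An isomorphism of hypergraphs matches the positions on the cycles, hence the bases together with
their structure constants (`ArcBasis.nonempty_algEquiv`).

Conversely, the vertices are the characters of `T(A)` (`ArcBasis.character_bijective`), their common
kernel `r` is spanned by the arcs, and the left annihilator of `r` is spanned by the full turns. For
`v₁, …, vₙ` with `n ≥ 2`, multiply the spaces `K e_{vᵢ} + r`, with a factor `r` between neighbours.
Modulo `r ^ n` and the annihilator, the dimension of the product is the number of positions from
which `v₁ … vₙ` is read within one turn (`ArcBasis.finrank_throughCharacters`). All these spaces are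
defined by the algebra alone. Subtracting the counts of the one-letter extensions of a word leaves
the number of positions from which it is exactly one turn, and these numbers determine the family of
cycles (`Pos.exists_equiv_of_fullCount_eq`).

Words of length one have no proper arcs, so these dimensions do not see them. The added trivial
paths repair this: a vertex has a word of length one if and only if it occurs at most once in the
longer words (`IsAlmostGentle.isReduced_pathWords`). -/

theorem exists_equiv_of_card_fiber {X Y Z : Type*} [Finite X] [Finite Y] (f : X → Z) (g : Y → Z)
    (h : ∀ z, Nat.card {x // f x = z} = Nat.card {y // g y = z}) :
    ∃ e : X ≃ Y, ∀ x, g (e x) = f x := by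
  have E : ∀ z, {x // f x = z} ≃ {y // g y = z} := fun z =>
    (Finite.equivFin _).trans ((finCongr (h z)).trans (Finite.equivFin _).symm)
  refine ⟨(Equiv.sigmaFiberEquiv f).symm.trans
    ((Equiv.sigmaCongrRight E).trans (Equiv.sigmaFiberEquiv g)), fun x => ?_⟩
  exact (E (f x) ⟨x, rfl⟩).2

/-- The positions in a family of words. -/
abbrev Pos {ι V : Type*} (c : ι → List V) : Type _ := Σ P : ι, Fin (c P).length

namespace Pos

variable {ι V : Type*} {c : ι → List V}

/-- The length of the word to which a position belongs. -/
def per (x : Pos c) : ℕ := (c x.1).length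

theorem per_pos (x : Pos c) : 0 < x.per := x.2.pos

/-- The letter at a position. -/
def label (x : Pos c) : V := (c x.1)[x.2]

/-- The cyclically next position. -/
def next (x : Pos c) : Pos c := ⟨x.1, ⟨(x.2 + 1) % (c x.1).length, Nat.mod_lt _ x.2.pos⟩⟩

theorem ext {x y : Pos c} (h : x.1 = y.1) (h' : (x.2 : ℕ) = y.2) : x = y := by
  obtain ⟨P, i⟩ := x
  obtain ⟨Q, j⟩ := y
  cases h
  exact congrArg (Sigma.mk P) (Fin.ext h')

theorem next_iterate_fst (x : Pos c) (k : ℕ) : (next^[k] x).1 = x.1 := by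
  induction k with
  | zero => rfl
  | succ k ih => rw [Function.iterate_succ_apply']; exact ih

theorem next_iterate_snd (x : Pos c) (k : ℕ) :
    ((next^[k] x).2 : ℕ) = (x.2 + k) % (c x.1).length := by
  induction k with
  | zero => exact (Nat.mod_eq_of_lt x.2.2).symm
  | succ k ih =>
    rw [Function.iterate_succ_apply']
    change ((next^[k] x).2 + 1 : ℕ) % (c (next^[k] x).1).length = _
    rw [ih, next_iterate_fst, Nat.mod_add_mod, Nat.add_assoc]

theorem eq_iterate_iff {x y : Pos c} {k : ℕ} :
    y = next^[k] x ↔ y.1 = x.1 ∧ (y.2 : ℕ) = (x.2 + k) % (c x.1).length := by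
  constructor
  · rintro rfl
    exact ⟨next_iterate_fst x k, next_iterate_snd x k⟩
  · rintro ⟨h, h'⟩
    exact ext (h.trans (next_iterate_fst x k).symm) (h'.trans (next_iterate_snd x k).symm)

theorem per_iterate (x : Pos c) (k : ℕ) : (next^[k] x).per = x.per := by
  rw [per, next_iterate_fst, per]

theorem iterate_per (x : Pos c) : next^[x.per] x = x := by
  refine (eq_iterate_iff.2 ⟨rfl, ?_⟩).symm
  rw [per, Nat.add_mod_right, Nat.mod_eq_of_lt x.2.2]

theorem next_injective : Function.Injective (next (c := c)) := by
  intro x y h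
  have hp : x.per = y.per := by
    have := congrArg per h
    rwa [← Function.iterate_one (next (c := c)), per_iterate, per_iterate] at this
  rw [← iterate_per x, ← iterate_per y, ← hp]
  obtain ⟨k, hk⟩ := Nat.exists_eq_succ_of_ne_zero x.per_pos.ne'
  rw [hk, Function.iterate_succ_apply, Function.iterate_succ_apply, h]

theorem iterate_injective (k : ℕ) : Function.Injective (next (c := c))^[k] :=
  next_injective.iterate k

theorem label_iterate (x : Pos c) (k : ℕ) :
    (next^[k] x).label = (c x.1)[(x.2 + k) % (c x.1).length]'(Nat.mod_lt _ x.2.pos) := by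
  rw [label]
  have h1 := next_iterate_fst x k
  have h2 := next_iterate_snd x k
  generalize next^[k] x = y at *
  obtain ⟨P, i⟩ := x
  obtain ⟨Q, j⟩ := y
  cases h1
  simp only [Fin.getElem_fin]
  exact getElem_congr_idx h2

/-- The word of length `k` read from a position. -/
def word (k : ℕ) (x : Pos c) : List V := (List.range k).map fun i => (next^[i] x).label

@[simp] theorem length_word (k : ℕ) (x : Pos c) : (word k x).length = k := by simp [word]

theorem word_succ (k : ℕ) (x : Pos c) : word (k + 1) x = x.label :: word k x.next := by
  simp [word, List.range_succ_eq_map]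

theorem word_succ' (k : ℕ) (x : Pos c) :
    word (k + 1) x = word k x ++ [(next^[k] x).label] := by
  simp [word, List.range_succ]

theorem word_per (x : Pos c) : word x.per x = (c x.1).rotate x.2 := by
  refine List.ext_getElem (by simp [per]) fun i h1 h2 => ?_
  rw [List.getElem_rotate]
  simp only [word, List.getElem_map, List.getElem_range, label_iterate]
  exact getElem_congr_idx (by rw [Nat.add_comm])

variable (c) in
/-- The number of positions from which the word `w` is read without running through a whole
cycle. -/
def count (w : List V) : ℕ := Nat.card {x : Pos c // w.length ≤ x.per ∧ word w.length x = w}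

variable (c) in
/-- The number of positions from which `w` is read as a whole cycle. -/
def fullCount (w : List V) : ℕ := Nat.card {x : Pos c // word x.per x = w}

/-- A word that stops short of a full turn can be extended by exactly one letter, the label of the
following position. -/
theorem card_eq_sum_count [Finite ι] [Fintype V] (w : List V) :
    Nat.card {x : Pos c // w.length < x.per ∧ word w.length x = w} =
      ∑ u : V, count c (w ++ [u]) := by
  classical
  have := Fintype.ofFinite (Pos c)
  simp only [count, Nat.card_eq_fintype_card, Fintype.card_subtype]
  rw [Finset.card_eq_sum_card_fiberwise (f := fun x : Pos c => (next^[w.length] x).label)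
    (t := Finset.univ) (fun _ _ => Finset.mem_coe.2 (Finset.mem_univ _))]
  refine Finset.sum_congr rfl fun u _ => congrArg Finset.card ?_
  ext x
  simp only [Finset.mem_filter, Finset.mem_univ, true_and, List.length_append, List.length_cons,
    List.length_nil, zero_add, word_succ', Nat.add_one_le_iff]
  rw [and_assoc]
  refine and_congr_right fun _ => ⟨?_, fun h => ?_⟩
  · rintro ⟨h, h'⟩
    rw [h, h']
  · obtain ⟨h, h'⟩ := List.append_inj' h rfl
    exact ⟨h, by simpa using h'⟩

/-- Reading `w` either completes the turn or leaves room for one more letter. This lets the full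
turns be computed from the counts of partial readings. -/
theorem count_eq [Finite ι] [Fintype V] (w : List V) :
    count c w = fullCount c w + ∑ u : V, count c (w ++ [u]) := by
  classical
  have := Fintype.ofFinite (Pos c)
  rw [← card_eq_sum_count]
  simp only [count, fullCount, Nat.card_eq_fintype_card, Fintype.card_subtype]
  rw [← Finset.card_union_of_disjoint]
  · congr 1
    ext x
    simp only [Finset.mem_filter, Finset.mem_univ, true_and, Finset.mem_union]
    constructor
    · rintro ⟨h, h'⟩
      rcases h.eq_or_lt with h | h
      · exact Or.inl (h ▸ h')
      · exact Or.inr ⟨h, h'⟩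
    · rintro (h | h)
      · have := congrArg List.length h
        rw [length_word] at this
        exact ⟨this.ge, this ▸ h⟩
      · exact ⟨h.1.le, h.2⟩
  · rw [Finset.disjoint_left]
    intro x hx hx'
    simp only [Finset.mem_filter, Finset.mem_univ, true_and] at hx hx'
    have := congrArg List.length hx
    rw [length_word] at this
    omega

end Pos

/-- A family of words is reduced when its words of length one are exactly the letters which occur
at most once in the longer words, each of them once. -/
def IsReduced {ι V : Type*} (c : ι → List V) : Prop :=
  ∀ v, Nat.card {x : Pos c // x.per = 1 ∧ x.label = v} =
    if Nat.card {x : Pos c // 1 < x.per ∧ x.label = v} ≤ 1 then 1 else 0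

/-! ### Families of cyclic words determined by their counts -/

namespace Pos

variable {ι κ V W : Type*} {c : ι → List V}
  {c' : κ → List W}

/-- The occurrences of `v` in longer words are counted by the two-letter words that begin with `v`,
so reducedness turns the count of one-letter words into data about words of length two. -/
theorem fullCount_singleton [Finite ι] [Fintype V] (hc : IsReduced c) (v : V) :
    fullCount c [v] = if ∑ u : V, count c [v, u] ≤ 1 then 1 else 0 := by
  have h1 := card_eq_sum_count (c := c) [v]
  have h2 : ∀ x : Pos c, word 1 x = [v] ↔ x.label = v := fun x => by simp [word]
  simp only [List.length_singleton, h2, List.singleton_append] at h1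
  rw [← h1, ← hc v, fullCount]
  refine Nat.card_congr (Equiv.subtypeEquivRight fun x => ⟨fun h => ?_, fun h => ?_⟩)
  · have := congrArg List.length h
    rw [length_word] at this
    rw [this] at h
    exact ⟨this, (h2 x).1 h⟩
  · rw [h.1]
    exact (h2 x).2 h.2

theorem fullCount_nil : fullCount c [] = 0 := by
  rw [fullCount, Nat.card_eq_zero]
  refine Or.inl ⟨fun x => ?_⟩
  have := congrArg List.length x.2
  rw [length_word] at this
  exact x.1.per_pos.ne' this

theorem fullCount_eq_of_count_eq [Finite ι] [Finite κ] [Fintype V] [Fintype W] (ε : V ≃ W)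
    (hc : IsReduced c) (hc' : IsReduced c')
    (h : ∀ w : List V, 2 ≤ w.length → count c w = count c' (w.map ε)) (w : List V) :
    fullCount c w = fullCount c' (w.map ε) := by
  have hs : ∀ w : List V, 1 ≤ w.length →
      ∑ u : V, count c (w ++ [u]) = ∑ u : W, count c' (w.map ε ++ [u]) := by
    intro w hw
    rw [← Equiv.sum_comp ε]
    refine Finset.sum_congr rfl fun u _ => ?_
    rw [h _ (by simp; omega)]
    simp
  match w with
  | [] => simp only [List.map_nil, fullCount_nil]
  -- The hypothesis says nothing about words of length one, so `count_eq` is of no use here;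
  -- reducedness takes its place.
  | [v] =>
    have := hs [v] le_rfl
    simp only [List.map_cons, List.map_nil, List.singleton_append] at this ⊢
    rw [fullCount_singleton hc, fullCount_singleton hc', this]
  | a :: b :: w =>
    have h1 := count_eq (c := c) (a :: b :: w)
    have h2 := count_eq (c := c') ((a :: b :: w).map ε)
    rw [h _ (by simp), hs _ (by simp)] at h1
    omega

theorem card_fiber_cycle (f : ι → Cycle W) (hf : ∀ P, (f P).length = (c P).length)
    (C : Cycle W) :
    Nat.card {x : Pos c // f x.1 = C} = Nat.card {P // f P = C} * C.length := by
  have e : {x : Pos c // f x.1 = C} ≃ {P // f P = C} × Fin C.length :=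
    { toFun := fun x => (⟨x.1.1, x.2⟩, ⟨x.1.2, by
        exact x.1.2.2.trans_eq ((hf _).symm.trans (congrArg Cycle.length x.2))⟩)
      invFun := fun y => ⟨⟨y.1.1, ⟨y.2, by rw [← hf, y.1.2]; exact y.2.2⟩⟩, y.1.2⟩
      left_inv := fun x => rfl
      right_inv := fun y => rfl }
  rw [Nat.card_congr e, Nat.card_prod, Nat.card_fin]

/-- The full turn read from a position is a rotation of its word. A bijection of positions that
preserves full turns therefore preserves cycles, although it may mix different words with the same
cycle. Dividing the number of positions on a given cycle by its length gives the number of words. -/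
theorem exists_equiv_of_fullCount_eq [Finite ι] [Finite κ] (ε : V ≃ W)
    (hn : ∀ P, c P ≠ []) (hn' : ∀ P, c' P ≠ [])
    (h : ∀ w : List V, fullCount c w = fullCount c' (w.map ε)) :
    ∃ v : ι ≃ κ, ∀ P, (c P : Cycle V).map ε = (c' (v P) : Cycle W) := by
  obtain ⟨e, he⟩ := exists_equiv_of_card_fiber (X := Pos c) (Y := Pos c')
    (fun x => (word x.per x).map ε) (fun x => word x.per x) fun z => by
      have hz : z = (z.map ε.symm).map ε := by simp
      rw [hz]
      refine Eq.trans ?_ (h (z.map ε.symm))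
      exact Nat.card_congr (Equiv.subtypeEquivRight fun x =>
        (List.map_injective_iff.2 ε.injective).eq_iff)
  have hcyc : ∀ x : Pos c, (c x.1 : Cycle V).map ε = (c' (e x).1 : Cycle W) := by
    intro x
    have := he x
    simp only [word_per] at this
    change (((c x.1).map ε : List W) : Cycle W) = _
    rw [Cycle.coe_eq_coe]
    have h1 : (c x.1).map ε ~r ((c x.1).rotate x.2).map ε := by
      rw [List.map_rotate]
      exact ⟨_, rfl⟩
    refine h1.trans ?_
    rw [← this]
    exact List.IsRotated.symm ⟨_, rfl⟩
  obtain ⟨v, hv⟩ := exists_equiv_of_card_fiber (X := ι) (Y := κ)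
    (fun P => (c P : Cycle V).map ε) (fun P => (c' P : Cycle W)) fun C => by
      -- Division by the length fails for the empty cycle, which does not occur because all words
      -- are nonempty.
      by_cases hC : C.length = 0
      · have h1 : IsEmpty {P // (c P : Cycle V).map ε = C} := ⟨fun P => hn P.1 (by
          have := congrArg Cycle.length P.2
          rw [hC] at this
          simpa using this)⟩
        have h2 : IsEmpty {P // (c' P : Cycle W) = C} := ⟨fun P => hn' P.1 (by
          have := congrArg Cycle.length P.2
          rw [hC] at this
          simpa using this)⟩
        rw [Nat.card_of_isEmpty, Nat.card_of_isEmpty]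
      · refine Nat.eq_of_mul_eq_mul_right (Nat.pos_of_ne_zero hC) ?_
        rw [← card_fiber_cycle (c := c) _ (by simp), ← card_fiber_cycle (c := c') _ (by simp)]
        refine Nat.card_congr (e.subtypeEquiv fun x => ?_)
        rw [hcyc]
  exact ⟨v, fun P => (hv P).symm⟩

theorem mod_sub_mod_add_mod {j n : ℕ} (t : ℕ) (hj : j < n) :
    ((j + (n - t % n)) % n + t) % n = j := by
  have h1 := (Nat.mod_lt t (Nat.zero_lt_of_lt hj)).le
  rw [Nat.mod_add_mod, ← Nat.add_mod_mod, Nat.add_assoc, Nat.sub_add_cancel h1,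
    Nat.add_mod_right, Nat.mod_eq_of_lt hj]

/-- Equal cycles are rotations of each other; shifting the positions of each word by a chosen amount
of rotation commutes with `next`. -/
theorem exists_posEquiv (ε : V ≃ W) (v : ι ≃ κ)
    (h : ∀ P, (c P : Cycle V).map ε = (c' (v P) : Cycle W)) :
    ∃ e : Pos c ≃ Pos c', (∀ x, (e x).per = x.per) ∧ (∀ x, (e x).next = e x.next) ∧
      ∀ x, (e x).label = ε x.label := by
  have hr : ∀ P, ∃ t, (c' (v P)).rotate t = (c P).map ε := fun P =>
    (Cycle.coe_eq_coe.1 (h P)).symm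
  choose t ht using hr
  have hl : ∀ P, (c' (v P)).length = (c P).length := fun P => by
    have := congrArg List.length (ht P)
    rwa [List.length_rotate, List.length_map] at this
  let f : Pos c → Pos c' := fun x => ⟨v x.1, ⟨(x.2 + t x.1) % (c' (v x.1)).length,
    Nat.mod_lt _ (by rw [hl]; exact x.2.pos)⟩⟩
  have hf : Function.Bijective f := by
    constructor
    · rintro ⟨P, i⟩ ⟨Q, j⟩ hxy
      obtain rfl : P = Q := v.injective (congrArg Sigma.fst hxy)
      refine Pos.ext rfl ?_
      have h2 : (i + t P) % (c' (v P)).length = (j + t P) % (c' (v P)).length := by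
        have := congrArg (fun y : Pos c' => (y.2 : ℕ)) hxy
        exact this
      have h3 : (i : ℕ) ≡ j [MOD (c' (v P)).length] := Nat.ModEq.add_right_cancel' _ h2
      rw [hl] at h3
      exact Nat.ModEq.eq_of_lt_of_lt h3 i.2 j.2
    · rintro ⟨Q, j⟩
      obtain ⟨P, rfl⟩ := v.surjective Q
      have hpos : 0 < (c P).length := by rw [← hl]; exact j.pos
      -- The preimage is `j - t` modulo the length, written so that the subtraction of natural
      -- numbers does not truncate.
      refine ⟨⟨P, ⟨(j + ((c P).length - t P % (c P).length)) % (c P).length,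
        Nat.mod_lt _ hpos⟩⟩, Pos.ext rfl ?_⟩
      change ((j + ((c P).length - t P % (c P).length)) % (c P).length + t P) %
        (c' (v P)).length = j
      exact (congrArg (_ % ·) (hl P)).trans (mod_sub_mod_add_mod _ (j.2.trans_eq (hl P)))
  refine ⟨Equiv.ofBijective f hf, fun x => hl x.1, fun x => Pos.ext rfl ?_, fun x => ?_⟩
  · change ((x.2 + t x.1) % (c' (v x.1)).length + 1) % (c' (v x.1)).length =
      ((x.2 + 1) % (c x.1).length + t x.1) % (c' (v x.1)).length
    rw [hl, Nat.mod_add_mod, Nat.mod_add_mod, Nat.add_right_comm]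
  · change (c' (v x.1))[(x.2 + t x.1) % (c' (v x.1)).length]'_ = ε ((c x.1)[x.2])
    have h1 : (x.2 : ℕ) < ((c' (v x.1)).rotate (t x.1)).length := by
      rw [List.length_rotate, hl]
      exact x.2.2
    have h2 := List.getElem_rotate (c' (v x.1)) (t x.1) x.2 h1
    refine h2.symm.trans ?_
    simp only [ht, List.getElem_map, Fin.getElem_fin]

end Pos

/-- By `count_order`, the multiplicity of a vertex in a hyperedge is read off the cyclic ordering at
the vertex, so compatibility with the orderings suffices for an isomorphism. -/
theorem OrientedHypergraph.map_edge_of_map_order (G : OrientedHypergraph.{u₁, u₂})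
    (H : OrientedHypergraph.{u₃, u₄}) (v : G.Vert ≃ H.Vert) (ε : G.Edge ≃ H.Edge)
    (h : ∀ x, (G.order x).map ε = H.order (v x)) (e : G.Edge) :
    (G.edge e).map v = H.edge (ε e) := by
  classical
  ext y
  obtain ⟨x, rfl⟩ := v.surjective y
  have h1 := G.count_order x e
  have h2 := H.count_order (v x) (ε e)
  rw [Multiset.count_map_eq_count' _ _ v.injective]
  have h3 : (H.order (v x)).toMultiset = (G.order x).toMultiset.map ε := by
    rw [← h]
    induction G.order x using Quotient.inductionOn' with
    | h l => rfl
  rw [h3, Multiset.count_map_eq_count' _ _ ε.injective] at h2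
  convert h1.symm.trans h2 using 1

/-! ### Algebras with a basis of cyclic arcs -/

/-- The index set of the basis of arcs: idempotents, socle elements and proper arcs. -/
abbrev ArcIndex {ι V : Type*} (c : ι → List V) : Type _ :=
  V ⊕ V ⊕ Σ x : Pos c, Fin (x.per - 1)

/-- A presentation of an algebra by a family of cyclic words: the algebra has a basis formed by
orthogonal idempotents `e v`, socle elements `s v`, and arcs which start at a position and do not
run through a whole cycle. -/
structure ArcBasis (K T : Type*) [Field K] [Ring T] [Algebra K T] {ι V : Type*} [Fintype V]
    (c : ι → List V) where
  basis : Basis (ArcIndex c) K T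
  arc : Pos c → ℕ → T
  arc_lt : ∀ (x : Pos c) (i : Fin (x.per - 1)), arc x (i + 1) = basis (.inr (.inr ⟨x, i⟩))
  arc_per : ∀ x : Pos c, arc x x.per = basis (.inr (.inl x.label))
  arc_gt : ∀ (x : Pos c) (l : ℕ), x.per < l → arc x l = 0
  arc_mul_arc : ∀ (x : Pos c) (l m : ℕ), 1 ≤ l → 1 ≤ m →
    arc x l * arc (Pos.next^[l] x) m = arc x (l + m)
  arc_mul_arc_of_ne : ∀ (x y : Pos c) (l m : ℕ), 1 ≤ l → 1 ≤ m → y ≠ Pos.next^[l] x →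
    arc x l * arc y m = 0
  e_mul_e : ∀ v, basis (.inl v) * basis (.inl v) = basis (.inl v)
  e_mul_e_of_ne : ∀ u v, u ≠ v → basis (.inl u) * basis (.inl v) = 0
  sum_e : ∑ v, basis (.inl v) = 1
  e_mul_arc : ∀ (x : Pos c) (l : ℕ), 1 ≤ l → basis (.inl x.label) * arc x l = arc x l
  arc_mul_e : ∀ (x : Pos c) (l : ℕ), 1 ≤ l →
    arc x l * basis (.inl (Pos.next^[l] x).label) = arc x l
  label_surjective : ∀ v, ∃ x : Pos c, x.label = v

namespace ArcBasis

variable {K T ι V : Type*} [Field K] [Ring T] [Algebra K T] [Fintype V] {c : ι → List V}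
  (m : ArcBasis K T c)

/-- The idempotent of a letter. -/
abbrev e (v : V) : T := m.basis (.inl v)

theorem e_mul_arc_of_ne {v : V} {x : Pos c} (h : x.label ≠ v) {l : ℕ} (hl : 1 ≤ l) :
    m.e v * m.arc x l = 0 := by
  rw [← m.e_mul_arc x l hl, ← mul_assoc, m.e_mul_e_of_ne _ _ h.symm, zero_mul]

theorem arc_mul_e_of_ne {v : V} {x : Pos c} {l : ℕ} (h : (Pos.next^[l] x).label ≠ v)
    (hl : 1 ≤ l) : m.arc x l * m.e v = 0 := by
  rw [← m.arc_mul_e x l hl, mul_assoc, m.e_mul_e_of_ne _ _ h, mul_zero]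

/-- Every letter occurs somewhere, so a socle element is a full turn. Linear and bilinear identities
need only be tested on idempotents and arcs. -/
theorem basis_eq (i : ArcIndex c) :
    (∃ v, m.basis i = m.e v) ∨ ∃ x l, 1 ≤ l ∧ m.basis i = m.arc x l := by
  rcases i with v | v | ⟨x, i⟩
  · exact Or.inl ⟨v, rfl⟩
  · obtain ⟨x, rfl⟩ := m.label_surjective v
    exact Or.inr ⟨x, _, x.per_pos, (m.arc_per x).symm⟩
  · exact Or.inr ⟨x, _, Nat.le_add_left _ _, (m.arc_lt x i).symm⟩

theorem arc_eq (x : Pos c) {l : ℕ} (hl : 1 ≤ l) :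
    (∃ i : Fin (x.per - 1), l = i + 1 ∧ m.arc x l = m.basis (.inr (.inr ⟨x, i⟩))) ∨
      (l = x.per ∧ m.arc x l = m.basis (.inr (.inl x.label))) ∨
      (x.per < l ∧ m.arc x l = 0) := by
  rcases lt_trichotomy l x.per with h | h | h
  · obtain ⟨l, rfl⟩ := Nat.exists_eq_add_of_le' hl
    exact Or.inl ⟨⟨l, by omega⟩, rfl, m.arc_lt x ⟨l, by omega⟩⟩
  · exact Or.inr (Or.inl ⟨h, h ▸ m.arc_per x⟩)
  · exact Or.inr (Or.inr ⟨h, m.arc_gt x l h⟩)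

theorem linearMap_ext {N : Type*} [AddCommMonoid N] [Module K N] {f g : T →ₗ[K] N}
    (he : ∀ v, f (m.e v) = g (m.e v)) (ha : ∀ x l, 1 ≤ l → f (m.arc x l) = g (m.arc x l)) :
    f = g := by
  refine m.basis.ext fun i => ?_
  rcases m.basis_eq i with ⟨v, h⟩ | ⟨x, l, hl, h⟩
  · rw [h, he]
  · rw [h, ha x l hl]

theorem bilinear_ext {N : Type*} [AddCommMonoid N] [Module K N] {f g : T →ₗ[K] T →ₗ[K] N}
    (hee : ∀ u v, f (m.e u) (m.e v) = g (m.e u) (m.e v))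
    (hea : ∀ u x l, 1 ≤ l → f (m.e u) (m.arc x l) = g (m.e u) (m.arc x l))
    (hae : ∀ u x l, 1 ≤ l → f (m.arc x l) (m.e u) = g (m.arc x l) (m.e u))
    (haa : ∀ x l y k, 1 ≤ l → 1 ≤ k →
      f (m.arc x l) (m.arc y k) = g (m.arc x l) (m.arc y k)) : f = g := by
  refine m.linearMap_ext (fun v => ?_) fun x l hl => ?_
  · exact m.linearMap_ext (hee v) (hea v)
  · exact m.linearMap_ext (fun v => hae v x l hl) fun y k => haa x l y k hl

section Iso

variable {T' κ W : Type*} [Ring T'] [Algebra K T'] [Fintype W] {c' : κ → List W}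

/-- Transport along an isomorphism of algebras. -/
def map (φ : T ≃ₐ[K] T') : ArcBasis K T' c where
  basis := m.basis.map φ.toLinearEquiv
  arc x l := φ (m.arc x l)
  arc_lt x i := by simp [m.arc_lt]
  arc_per x := by simp [m.arc_per]
  arc_gt x l h := by simp [m.arc_gt x l h]
  arc_mul_arc x l k hl hk := by rw [← map_mul, m.arc_mul_arc x l k hl hk]
  arc_mul_arc_of_ne x y l k hl hk h := by
    rw [← map_mul, m.arc_mul_arc_of_ne x y l k hl hk h, map_zero]
  e_mul_e v := by simp [← map_mul, m.e_mul_e]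
  e_mul_e_of_ne u v h := by simp [← map_mul, m.e_mul_e_of_ne u v h]
  sum_e := by simp [← map_sum, m.sum_e]
  e_mul_arc x l hl := by simp [← map_mul, m.e_mul_arc x l hl]
  arc_mul_e x l hl := by simp [← map_mul, m.arc_mul_e x l hl]
  label_surjective := m.label_surjective

/-- The structure constants depend only on lengths of words, successors of positions, and labels. A
bijection of positions that respects these induces a multiplicative bijection of bases. -/
theorem nonempty_algEquiv (m : ArcBasis K T c) (m' : ArcBasis K T' c') (p : Pos c ≃ Pos c') (ε : V ≃ W)
    (hper : ∀ x, (p x).per = x.per) (hnext : ∀ x, (p x).next = p x.next)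
    (hlabel : ∀ x, (p x).label = ε x.label) : Nonempty (T ≃ₐ[K] T') := by
  let Φ : ArcIndex c ≃ ArcIndex c' := Equiv.sumCongr ε (Equiv.sumCongr ε
    (Equiv.sigmaCongr p fun x => finCongr (by rw [hper])))
  let L : T ≃ₗ[K] T' := m.basis.equiv m'.basis Φ
  have hiter : ∀ (l : ℕ) x, Pos.next^[l] (p x) = p (Pos.next^[l] x) := by
    intro l
    induction l with
    | zero => exact fun x => rfl
    | succ l ih =>
      intro x
      rw [Function.iterate_succ_apply, Function.iterate_succ_apply, hnext, ih]
  have he : ∀ v, L (m.e v) = m'.e (ε v) := fun v => m.basis.equiv_apply _ _ _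
  have ha : ∀ x l, 1 ≤ l → L (m.arc x l) = m'.arc (p x) l := by
    intro x l hl
    rcases m.arc_eq x hl with ⟨i, rfl, h⟩ | ⟨rfl, h⟩ | ⟨h', h⟩
    · rw [h]
      refine (m.basis.equiv_apply _ _ _).trans ?_
      exact (m'.arc_lt (p x) (finCongr (by rw [hper]) i)).symm
    · rw [h]
      refine (m.basis.equiv_apply _ _ _).trans ?_
      have := m'.arc_per (p x)
      rw [hper, hlabel] at this
      exact this.symm
    · rw [h, map_zero, m'.arc_gt _ _ (by rwa [hper])]
  have hmul : (LinearMap.mul K T).compr₂ L.toLinearMap =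
      (LinearMap.mul K T').compl₁₂ L.toLinearMap L.toLinearMap := by
    refine m.bilinear_ext (fun u v => ?_) (fun u x l hl => ?_) (fun u x l hl => ?_)
      fun x l y k hl hk => ?_
    · change L (m.e u * m.e v) = L (m.e u) * L (m.e v)
      rw [he, he]
      by_cases h : u = v
      · rw [h, m.e_mul_e, m'.e_mul_e, he]
      · rw [m.e_mul_e_of_ne _ _ h, m'.e_mul_e_of_ne _ _ (ε.injective.ne h), map_zero]
    · change L (m.e u * m.arc x l) = L (m.e u) * L (m.arc x l)
      rw [he, ha x l hl]
      by_cases h : x.label = u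
      · rw [← h, m.e_mul_arc x l hl, ← hlabel, m'.e_mul_arc _ l hl, ha x l hl]
      · rw [m.e_mul_arc_of_ne h hl, m'.e_mul_arc_of_ne (by rwa [hlabel, ε.injective.ne_iff]) hl,
          map_zero]
    · change L (m.arc x l * m.e u) = L (m.arc x l) * L (m.e u)
      rw [he, ha x l hl]
      by_cases h : (Pos.next^[l] x).label = u
      · rw [← h, m.arc_mul_e x l hl, ← hlabel, ← hiter, m'.arc_mul_e _ l hl, ha x l hl]
      · rw [m.arc_mul_e_of_ne h hl,
          m'.arc_mul_e_of_ne (by rwa [hiter, hlabel, ε.injective.ne_iff]) hl, map_zero]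
    · change L (m.arc x l * m.arc y k) = L (m.arc x l) * L (m.arc y k)
      rw [ha x l hl, ha y k hk]
      by_cases h : y = Pos.next^[l] x
      · rw [h, m.arc_mul_arc x l k hl hk, ← hiter, m'.arc_mul_arc _ l k hl hk,
          ha _ _ (hl.trans (Nat.le_add_right _ _))]
      · rw [m.arc_mul_arc_of_ne x y l k hl hk h, m'.arc_mul_arc_of_ne _ _ l k hl hk
          (by rwa [hiter, p.injective.ne_iff]), map_zero]
  refine ⟨AlgEquiv.ofLinearEquiv L ?_ fun x y => LinearMap.congr_fun₂ hmul x y⟩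
  rw [← m.sum_e, ← m'.sum_e, map_sum, ← Equiv.sum_comp ε]
  exact Finset.sum_congr rfl fun v _ => he v

end Iso

/-! ### Recovering the counts of words from the algebra -/

theorem coord_inl_arc (v : V) (x : Pos c) {l : ℕ} (hl : 1 ≤ l) :
    m.basis.coord (.inl v) (m.arc x l) = 0 := by
  rcases m.arc_eq x hl with ⟨i, -, h⟩ | ⟨-, h⟩ | ⟨-, h⟩ <;> simp [h]

theorem coord_inl_e_self (v : V) : m.basis.coord (.inl v) (m.e v) = 1 := by simp

theorem coord_inl_e_of_ne {u v : V} (h : u ≠ v) : m.basis.coord (.inl v) (m.e u) = 0 := by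
  simp [h]

/-- The character of a letter. -/
def character (v : V) : T →ₐ[K] K :=
  AlgHom.ofLinearMap (m.basis.coord (.inl v))
    (by
      rw [← m.sum_e, map_sum, Finset.sum_eq_single v (fun u _ h => m.coord_inl_e_of_ne h)
        (by simp)]
      exact m.coord_inl_e_self v)
    (by
      have : (LinearMap.mul K T).compr₂ (m.basis.coord (.inl v)) =
          (LinearMap.mul K K).compl₁₂ (m.basis.coord (.inl v)) (m.basis.coord (.inl v)) := by
        refine m.bilinear_ext (fun u w => ?_) (fun u x l hl => ?_) (fun u x l hl => ?_)
          fun x l y k hl hk => ?_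
        · change m.basis.coord (.inl v) (m.e u * m.e w) =
            m.basis.coord (.inl v) (m.e u) * m.basis.coord (.inl v) (m.e w)
          by_cases h : u = w
          · rw [h, m.e_mul_e]
            by_cases hw : w = v
            · rw [hw, m.coord_inl_e_self, mul_one]
            · rw [m.coord_inl_e_of_ne hw, mul_zero]
          · rw [m.e_mul_e_of_ne _ _ h, map_zero]
            by_cases hw : w = v
            · rw [m.coord_inl_e_of_ne (hw ▸ h), zero_mul]
            · rw [m.coord_inl_e_of_ne hw, mul_zero]
        · change m.basis.coord (.inl v) (m.e u * m.arc x l) =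
            m.basis.coord (.inl v) (m.e u) * m.basis.coord (.inl v) (m.arc x l)
          rw [m.coord_inl_arc v x hl, mul_zero]
          by_cases h : x.label = u
          · rw [← h, m.e_mul_arc x l hl, m.coord_inl_arc v x hl]
          · rw [m.e_mul_arc_of_ne h hl, map_zero]
        · change m.basis.coord (.inl v) (m.arc x l * m.e u) =
            m.basis.coord (.inl v) (m.arc x l) * m.basis.coord (.inl v) (m.e u)
          rw [m.coord_inl_arc v x hl, zero_mul]
          by_cases h : (Pos.next^[l] x).label = u
          · rw [← h, m.arc_mul_e x l hl, m.coord_inl_arc v x hl]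
          · rw [m.arc_mul_e_of_ne h hl, map_zero]
        · change m.basis.coord (.inl v) (m.arc x l * m.arc y k) =
            m.basis.coord (.inl v) (m.arc x l) * m.basis.coord (.inl v) (m.arc y k)
          rw [m.coord_inl_arc v x hl, zero_mul]
          by_cases h : y = Pos.next^[l] x
          · rw [h, m.arc_mul_arc x l k hl hk,
              m.coord_inl_arc v x (hl.trans (Nat.le_add_right _ _))]
          · rw [m.arc_mul_arc_of_ne x y l k hl hk h, map_zero]
      exact fun x y => LinearMap.congr_fun₂ this x y)

theorem character_apply (v : V) (t : T) : m.character v t = m.basis.coord (.inl v) t := rfl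

/-- An arc can be composed with itself only if it ends where it begins; its powers then run around
the same cycle and eventually exceed a full turn. -/
theorem arc_pow (x : Pos c) {l : ℕ} (hl : 1 ≤ l) (k : ℕ) :
    m.arc x l ^ (k + 1) = 0 ∨ m.arc x l ^ (k + 1) = m.arc x ((k + 1) * l) := by
  induction k with
  | zero => exact Or.inr (by simp)
  | succ k ih =>
    rw [pow_succ']
    rcases ih with h | h
    · exact Or.inl (by rw [h, mul_zero])
    · have hk : 1 ≤ (k + 1) * l := Nat.mul_pos k.succ_pos hl
      rw [h]
      by_cases hx : x = Pos.next^[l] x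
      · right
        conv_lhs => rw [hx, ← hx]
        have := m.arc_mul_arc x l ((k + 1) * l) hl hk
        rw [← hx] at this
        rw [this]
        congr 1
        ring
      · exact Or.inl (m.arc_mul_arc_of_ne x x l _ hl hk hx)

theorem isNilpotent_arc (x : Pos c) {l : ℕ} (hl : 1 ≤ l) : IsNilpotent (m.arc x l) := by
  refine ⟨x.per + 1, ?_⟩
  rcases m.arc_pow x hl x.per with h | h
  · exact h
  · rw [h, m.arc_gt]
    exact Nat.lt_of_lt_of_le (Nat.lt_succ_self _) (Nat.le_mul_of_pos_right _ hl)

theorem algHom_arc (m : ArcBasis K T c) (χ : T →ₐ[K] K) (x : Pos c) {l : ℕ} (hl : 1 ≤ l) : χ (m.arc x l) = 0 :=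
  ((m.isNilpotent_arc x hl).map χ).eq_zero

/-- A character kills the arcs, which are nilpotent. On the orthogonal idempotents its values add up
to one while products of distinct values vanish, so exactly one idempotent survives. -/
theorem character_bijective : Function.Bijective m.character := by
  constructor
  · intro u v h
    by_contra huv
    have := congrArg (fun χ => χ (m.e u)) h
    simp only [character_apply, m.coord_inl_e_self, m.coord_inl_e_of_ne huv] at this
    exact one_ne_zero this
  · intro χ
    have h1 : ∑ v, χ (m.e v) = 1 := by rw [← map_sum, m.sum_e, map_one]
    obtain ⟨v, -, hv⟩ : ∃ v ∈ Finset.univ, χ (m.e v) ≠ 0 := by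
      by_contra! h
      rw [Finset.sum_eq_zero h] at h1
      exact zero_ne_one h1
    have h0 : ∀ u, u ≠ v → χ (m.e u) = 0 := fun u hu => by
      have := congrArg χ (m.e_mul_e_of_ne u v hu)
      rw [map_mul, map_zero] at this
      exact (mul_eq_zero.1 this).resolve_right hv
    rw [Finset.sum_eq_single v (fun u _ hu => h0 u hu) (by simp)] at h1
    refine ⟨v, AlgHom.toLinearMap_injective (m.linearMap_ext (fun u => ?_) fun x l hl => ?_)⟩
    · change m.character v (m.e u) = χ (m.e u)
      rw [character_apply]
      by_cases hu : u = v
      · rw [hu, m.coord_inl_e_self, h1]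
      · rw [m.coord_inl_e_of_ne hu, h0 u hu]
    · change m.character v (m.arc x l) = χ (m.arc x l)
      rw [m.algHom_arc _ x hl, m.algHom_arc _ x hl]

end ArcBasis

/-! ### Subspaces of an algebra defined by its characters -/

section Invariants

variable (K T : Type*) [Field K] [Ring T] [Algebra K T]

/-- The common kernel of all characters of an algebra. -/
def characterKernel : Submodule K T := ⨅ χ : T →ₐ[K] K, LinearMap.ker χ.toLinearMap

/-- The left annihilator of the common kernel of all characters. -/
def kernelAnnihilator : Submodule K T where
  carrier := {y | ∀ r ∈ characterKernel K T, y * r = 0}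
  add_mem' ha hb r hr := by rw [add_mul, ha r hr, hb r hr, add_zero]
  zero_mem' r _ := zero_mul r
  smul_mem' k a ha r hr := by rw [smul_mul_assoc, ha r hr, smul_zero]

variable {K T}

/-- The common kernel of all characters but one. -/
def otherKernel (χ : T →ₐ[K] K) : Submodule K T :=
  ⨅ ψ : {ψ : T →ₐ[K] K // ψ ≠ χ}, LinearMap.ker ψ.1.toLinearMap

/-- The products which run through a given sequence of characters. -/
def throughCharacters : List (T →ₐ[K] K) → Submodule K T
  | [] => ⊤
  | [χ] => otherKernel χ
  | χ :: ψ :: w => otherKernel χ * characterKernel K T * throughCharacters (ψ :: w)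

/-- The filtration by the powers of the common kernel, modulo its annihilator. -/
def kernelFiltration (K T : Type*) [Field K] [Ring T] [Algebra K T] (k : ℕ) : Submodule K T :=
  characterKernel K T ^ k ⊔ kernelAnnihilator K T

end Invariants

/-! ### The common kernel of the characters and its annihilator -/

namespace ArcBasis

variable {K T ι V : Type*} [Field K] [Ring T] [Algebra K T] [Fintype V] {c : ι → List V}
  (m : ArcBasis K T c)

/-- The span of the arcs of length at least `k`. -/
def fil (k : ℕ) : Submodule K T := Submodule.span K {t | ∃ x l, k ≤ l ∧ t = m.arc x l}

theorem arc_mem_fil (x : Pos c) {k l : ℕ} (h : k ≤ l) : m.arc x l ∈ m.fil k :=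
  Submodule.subset_span ⟨x, l, h, rfl⟩

theorem fil_antitone {j k : ℕ} (h : j ≤ k) : m.fil k ≤ m.fil j := by
  rw [fil, Submodule.span_le]
  rintro _ ⟨x, l, hl, rfl⟩
  exact m.arc_mem_fil x (h.trans hl)

theorem fil_mul_fil_le {j k : ℕ} (hj : 1 ≤ j) (hk : 1 ≤ k) :
    m.fil j * m.fil k ≤ m.fil (j + k) := by
  rw [fil, fil, Submodule.span_mul_span, Submodule.span_le]
  rintro _ ⟨_, ⟨x, l, hl, rfl⟩, _, ⟨y, n, hn, rfl⟩, rfl⟩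
  change m.arc x l * m.arc y n ∈ m.fil (j + k)
  by_cases h : y = Pos.next^[l] x
  · rw [h, m.arc_mul_arc x l n (hj.trans hl) (hk.trans hn)]
    exact m.arc_mem_fil x (add_le_add hl hn)
  · rw [m.arc_mul_arc_of_ne x y l n (hj.trans hl) (hk.trans hn) h]
    exact zero_mem _

/-- An arc of length at least `k + 1` is its first step followed by an arc of length at least `k`.
-/
theorem fil_one_mul_fil {k : ℕ} (hk : 1 ≤ k) : m.fil 1 * m.fil k = m.fil (k + 1) := by
  refine le_antisymm ((m.fil_mul_fil_le le_rfl hk).trans_eq (by rw [add_comm])) ?_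
  rw [fil, Submodule.span_le]
  rintro _ ⟨x, l, hl, rfl⟩
  have h := m.arc_mul_arc x 1 (l - 1) le_rfl (by omega)
  rw [Nat.add_sub_cancel' (by omega)] at h
  rw [← h]
  exact Submodule.mul_mem_mul (m.arc_mem_fil x le_rfl) (m.arc_mem_fil _ (by omega))

theorem mem_fil_one {t : T} (h : ∀ v, m.basis.coord (.inl v) t = 0) : t ∈ m.fil 1 := by
  rw [← m.basis.linearCombination_repr t]
  refine Submodule.sum_mem _ fun i hi => Submodule.smul_mem _ _ ?_
  rcases i with v | i
  · exact absurd (h v) (Finsupp.mem_support_iff.1 hi)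
  · rcases i with v | ⟨x, i⟩
    · obtain ⟨x, rfl⟩ := m.label_surjective v
      rw [← m.arc_per]
      exact m.arc_mem_fil x x.per_pos
    · rw [← m.arc_lt]
      exact m.arc_mem_fil x (Nat.le_add_left _ _)

theorem coord_inl_fil {t : T} (h : t ∈ m.fil 1) (v : V) : m.basis.coord (.inl v) t = 0 := by
  have : m.fil 1 ≤ LinearMap.ker (m.basis.coord (.inl v)) := by
    rw [fil, Submodule.span_le]
    rintro _ ⟨x, l, hl, rfl⟩
    exact m.coord_inl_arc v x hl
  exact this h

theorem characterKernel_eq : characterKernel K T = m.fil 1 := by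
  ext t
  rw [characterKernel, Submodule.mem_iInf]
  constructor
  · exact fun h => m.mem_fil_one fun v => h (m.character v)
  · intro h χ
    obtain ⟨v, rfl⟩ := m.character_bijective.2 χ
    exact m.coord_inl_fil h v

theorem characterKernel_pow {k : ℕ} (hk : 1 ≤ k) : characterKernel K T ^ k = m.fil k := by
  induction k, hk using Nat.le_induction with
  | base => rw [pow_one, m.characterKernel_eq]
  | succ k hk ih => rw [pow_succ', ih, m.characterKernel_eq, m.fil_one_mul_fil hk]

/-- An automorphism may move the idempotent of a letter, but its span modulo the arcs is determined
by the character. This is what makes the construction independent of the basis. -/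
theorem otherKernel_eq (v : V) :
    otherKernel (m.character v) = Submodule.span K {m.e v} ⊔ m.fil 1 := by
  refine le_antisymm (fun t ht => ?_) (sup_le ?_ ?_)
  · rw [otherKernel, Submodule.mem_iInf] at ht
    rw [← sub_add_cancel t (m.basis.coord (.inl v) t • m.e v), add_comm]
    refine Submodule.add_mem_sup (Submodule.smul_mem _ _ (Submodule.mem_span_singleton_self _))
      (m.mem_fil_one fun u => ?_)
    rw [map_sub, map_smul]
    by_cases hu : u = v
    · rw [hu, m.coord_inl_e_self, smul_eq_mul, mul_one, sub_self]
    · rw [m.coord_inl_e_of_ne (Ne.symm hu), smul_zero, sub_zero]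
      exact ht ⟨m.character u, m.character_bijective.1.ne hu⟩
  · rw [Submodule.span_le, Set.singleton_subset_iff]
    refine Submodule.mem_iInf _ |>.2 fun ψ => ?_
    obtain ⟨ψ, hψ⟩ := ψ
    obtain ⟨u, rfl⟩ := m.character_bijective.2 ψ
    exact m.coord_inl_e_of_ne fun h => hψ (congrArg _ h.symm)
  · rw [← m.characterKernel_eq]
    exact le_iInf fun ψ => iInf_le _ ψ.1

/-- The span of the socle elements. -/
def socle : Submodule K T := Submodule.span K (Set.range fun v => m.basis (.inr (.inl v)))

/-- Each coordinate of `t` outside the socle can be recovered from a product of `t` with an arc that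
completes a full turn. If all such products vanish, only socle coordinates remain. -/
theorem kernelAnnihilator_eq : kernelAnnihilator K T = m.socle := by
  refine le_antisymm (fun t ht => ?_) ?_
  · change ∀ r ∈ characterKernel K T, t * r = 0 at ht
    rw [m.characterKernel_eq] at ht
    have he : ∀ v, m.basis.coord (.inl v) t = 0 := by
      intro v
      obtain ⟨x, rfl⟩ := m.label_surjective v
      -- Right multiplication by a full turn kills every arc and every idempotent except the one at
      -- its label.
      have key : m.basis.coord (.inr (.inl x.label)) ∘ₗ LinearMap.mulRight K (m.arc x x.per) =
          m.basis.coord (.inl x.label) := by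
        refine m.linearMap_ext (fun u => ?_) fun y l hl => ?_
        · change m.basis.coord _ (m.e u * m.arc x x.per) = _
          by_cases h : x.label = u
          · rw [← h, m.e_mul_arc x _ x.per_pos, m.arc_per, m.coord_inl_e_self]
            simp
          · rw [m.e_mul_arc_of_ne h x.per_pos, m.coord_inl_e_of_ne (Ne.symm h), map_zero]
        · change m.basis.coord _ (m.arc y l * m.arc x x.per) = _
          rw [m.coord_inl_arc _ y hl]
          by_cases h : x = Pos.next^[l] y
          · have hp : x.per = y.per := by rw [h, Pos.per_iterate]
            conv_lhs => rw [hp, h]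
            rw [m.arc_mul_arc y l y.per hl y.per_pos, m.arc_gt _ _ (by omega), map_zero]
          · rw [m.arc_mul_arc_of_ne y x l _ hl x.per_pos h, map_zero]
      rw [← key]
      change m.basis.coord _ (t * m.arc x x.per) = 0
      rw [ht _ (m.arc_mem_fil x x.per_pos), map_zero]
    have ha : ∀ (x : Pos c) (i : Fin (x.per - 1)),
        m.basis.coord (.inr (.inr ⟨x, i⟩)) t = 0 := by
      intro x i
      have hi := i.2
      -- The right factor is the arc that completes `⟨x, i⟩`, of length `i + 1`, to a full turn; no
      -- other basis element gives this socle element.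
      have key : m.basis.coord (.inr (.inl x.label)) ∘ₗ
          LinearMap.mulRight K (m.arc (Pos.next^[i + 1] x) (x.per - (i + 1))) =
          m.basis.coord (.inr (.inr ⟨x, i⟩)) := by
        refine m.linearMap_ext (fun u => ?_) fun y l hl => ?_
        · change m.basis.coord _ (m.e u * m.arc _ _) = _
          trans 0
          · by_cases h : (Pos.next^[i + 1] x).label = u
            · rw [← h, m.e_mul_arc _ _ (by omega)]
              rcases m.arc_eq (Pos.next^[i + 1] x) (l := x.per - (i + 1)) (by omega) with
                ⟨j, -, h⟩ | ⟨h, -⟩ | ⟨h, -⟩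
              · rw [h]
                simp
              · rw [Pos.per_iterate] at h
                omega
              · rw [Pos.per_iterate] at h
                omega
            · rw [m.e_mul_arc_of_ne h (by omega), map_zero]
          · simp
        · change m.basis.coord _ (m.arc y l * m.arc _ _) = _
          by_cases hx : y = x ∧ l = i + 1
          · obtain ⟨rfl, rfl⟩ := hx
            rw [m.arc_mul_arc y _ _ hl (by omega), Nat.add_sub_cancel' (by omega), m.arc_per,
              m.arc_lt]
            simp
          · trans 0
            · by_cases h : Pos.next^[i + 1] x = Pos.next^[l] y
              · rw [h, m.arc_mul_arc y _ _ hl (by omega)]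
                have hp : x.per = y.per := by rw [← Pos.per_iterate x, h, Pos.per_iterate]
                rcases m.arc_eq y (l := l + (x.per - (i + 1))) (by omega) with
                  ⟨j, -, h'⟩ | ⟨h', -⟩ | ⟨-, h'⟩
                · simp [h']
                -- The product is a full turn only for the length `i + 1`, and an arc is determined
                -- by its end point and its length.
                · have hl' : l = i + 1 := by omega
                  rw [hl'] at h
                  exact absurd ⟨(Pos.iterate_injective _ h).symm, hl'⟩ hx
                · rw [h', map_zero]
              · rw [m.arc_mul_arc_of_ne _ _ _ _ hl (by omega) h, map_zero]
            · rcases m.arc_eq y hl with ⟨j, h', h⟩ | ⟨-, h⟩ | ⟨-, h⟩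
              · rw [h]
                have : (⟨y, j⟩ : Σ x : Pos c, Fin (x.per - 1)) ≠ ⟨x, i⟩ := by
                  intro hh
                  cases hh
                  exact hx ⟨rfl, h'⟩
                simp [this]
              · simp [h]
              · simp [h]
      rw [← key]
      change m.basis.coord _ (t * m.arc _ _) = 0
      rw [ht _ (m.arc_mem_fil _ (by omega)), map_zero]
    rw [← m.basis.linearCombination_repr t]
    refine Submodule.sum_mem _ fun i hi => Submodule.smul_mem _ _ ?_
    rcases i with v | v | ⟨x, i⟩
    · exact absurd (he v) (Finsupp.mem_support_iff.1 hi)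
    · exact Submodule.subset_span ⟨v, rfl⟩
    · exact absurd (ha x i) (Finsupp.mem_support_iff.1 hi)
  · rw [socle, Submodule.span_le]
    rintro _ ⟨v, rfl⟩
    change ∀ r ∈ characterKernel K T, _ = 0
    obtain ⟨x, rfl⟩ := m.label_surjective v
    change ∀ r ∈ characterKernel K T, m.basis (.inr (.inl x.label)) * r = 0
    rw [m.characterKernel_eq, ← m.arc_per]
    change m.fil 1 ≤ LinearMap.ker (LinearMap.mulLeft K (m.arc x x.per))
    rw [fil, Submodule.span_le]
    rintro _ ⟨y, l, hl, rfl⟩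
    change m.arc x x.per * m.arc y l = 0
    by_cases h : y = Pos.next^[x.per] x
    · rw [h, m.arc_mul_arc x _ _ x.per_pos hl, m.arc_gt _ _ (by omega)]
    · exact m.arc_mul_arc_of_ne x y _ _ x.per_pos hl h

end ArcBasis

/-! ### Reading words along products of subspaces -/

namespace ArcBasis

variable {K T ι V : Type*} [Field K] [Ring T] [Algebra K T] [Fintype V] {c : ι → List V}
  (m : ArcBasis K T c)

/-- The arcs, with the idempotents as arcs of length zero. -/
def arcOrIdem (x : Pos c) (l : ℕ) : T := if l = 0 then m.e x.label else m.arc x l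

theorem arcOrIdem_of_pos (x : Pos c) {l : ℕ} (hl : 1 ≤ l) : m.arcOrIdem x l = m.arc x l :=
  if_neg (by omega)

/-- For `j = 0` the product is nonzero as soon as the labels agree, even if `y` is not the end of
the arc. Hence words are compared here, not positions. -/
theorem arc_mul_arcOrIdem (x y : Pos c) {l j : ℕ} (hl : 1 ≤ l) :
    m.arc x l * m.arcOrIdem y j = 0 ∨
      Pos.word (j + 1) (Pos.next^[l] x) = Pos.word (j + 1) y ∧
        m.arc x l * m.arcOrIdem y j = m.arc x (l + j) := by
  rcases Nat.eq_zero_or_pos j with rfl | hj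
  · rw [arcOrIdem, if_pos rfl]
    by_cases h : (Pos.next^[l] x).label = y.label
    · refine Or.inr ⟨by simp [Pos.word, h], ?_⟩
      rw [← h, m.arc_mul_e x l hl, add_zero]
    · exact Or.inl (m.arc_mul_e_of_ne h hl)
  · rw [m.arcOrIdem_of_pos y hj]
    by_cases h : y = Pos.next^[l] x
    · exact Or.inr ⟨by rw [h], by rw [h, m.arc_mul_arc x l j hl hj]⟩
    · exact Or.inl (m.arc_mul_arc_of_ne x y l j hl hj h)

/-- The span of the arcs along which a given word is read. -/
def reading (w : List V) : Submodule K T :=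
  Submodule.span K {t | ∃ x, Pos.word w.length x = w ∧ t = m.arcOrIdem x (w.length - 1)}

theorem otherKernel_mul_characterKernel_le (v : V) :
    otherKernel (m.character v) * characterKernel K T ≤
      Submodule.span K {t | ∃ x l, 1 ≤ l ∧ x.label = v ∧ t = m.arc x l} ⊔ m.fil 2 := by
  rw [m.otherKernel_eq, m.characterKernel_eq, Submodule.sup_mul]
  refine sup_le_sup ?_ (m.fil_mul_fil_le le_rfl le_rfl)
  rw [fil, Submodule.span_mul_span, Submodule.span_le]
  rintro _ ⟨_, rfl, _, ⟨x, l, hl, rfl⟩, rfl⟩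
  change m.e v * m.arc x l ∈ _
  by_cases h : x.label = v
  · rw [← h, m.e_mul_arc x l hl]
    exact Submodule.subset_span ⟨x, l, hl, rfl, rfl⟩
  · rw [m.e_mul_arc_of_ne h hl]
    exact zero_mem _

/-- A product of minimal length moves one step between consecutive letters and so reads the word.
Any longer factor, and any factor from `r` in place of an idempotent, pushes the product into the
next step of the filtration. -/
theorem throughCharacters_le (v : V) (w : List V) :
    throughCharacters ((v :: w).map m.character) ≤
      m.reading (v :: w) ⊔ m.fil (w.length + 1) := by
  induction w generalizing v with
  | nil =>
    change otherKernel (m.character v) ≤ _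
    rw [m.otherKernel_eq]
    refine sup_le_sup ?_ le_rfl
    rw [Submodule.span_le, Set.singleton_subset_iff]
    obtain ⟨x, rfl⟩ := m.label_surjective v
    exact Submodule.subset_span ⟨x, by simp [Pos.word], (if_pos rfl).symm⟩
  | cons v' w ih =>
    change otherKernel (m.character v) * characterKernel K T *
      throughCharacters ((v' :: w).map m.character) ≤ _
    refine (mul_le_mul' (m.otherKernel_mul_characterKernel_le v) (ih v')).trans ?_
    have hP : ∀ k, 1 ≤ k → m.fil k * m.reading (v' :: w) ≤ m.fil (k + w.length) := by
      intro k hk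
      rw [fil, reading, Submodule.span_mul_span, Submodule.span_le]
      rintro _ ⟨_, ⟨x, l, hl, rfl⟩, _, ⟨y, -, rfl⟩, rfl⟩
      change m.arc x l * m.arcOrIdem y ((v' :: w).length - 1) ∈ _
      rcases m.arc_mul_arcOrIdem x y (j := (v' :: w).length - 1) (hk.trans hl) with h | ⟨-, h⟩
      · rw [h]
        exact zero_mem _
      · rw [h]
        exact m.arc_mem_fil x (by simpa using hl)
    have hQ : Submodule.span K {t | ∃ x l, 1 ≤ l ∧ x.label = v ∧ t = m.arc x l} ≤ m.fil 1 := by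
      rw [Submodule.span_le]
      rintro _ ⟨x, l, hl, -, rfl⟩
      exact m.arc_mem_fil x hl
    rw [Submodule.sup_mul, Submodule.mul_sup, List.length_cons]
    refine sup_le (sup_le ?_ ?_) ?_
    · rw [reading, Submodule.span_mul_span, Submodule.span_le]
      rintro _ ⟨_, ⟨x, l, hl, hx, rfl⟩, _, ⟨y, hy, rfl⟩, rfl⟩
      change m.arc x l * m.arcOrIdem y ((v' :: w).length - 1) ∈ _
      rcases m.arc_mul_arcOrIdem x y (j := (v' :: w).length - 1) hl with h | ⟨h', h⟩
      · rw [h]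
        exact zero_mem _
      · rw [h]
        -- A first arc of length one extends the reading by the letter `v`; a longer one goes into
        -- the error term.
        rcases hl.eq_or_lt with rfl | hl
        · refine Submodule.mem_sup_left (Submodule.subset_span ⟨x, ?_, ?_⟩)
          · change Pos.word (w.length + 1 + 1) x = _
            rw [Pos.word_succ, hx]
            exact congrArg _ (h'.trans hy)
          · rw [m.arcOrIdem_of_pos x (by simp)]
            simp [add_comm]
        · exact Submodule.mem_sup_right (m.arc_mem_fil x (by simp; omega))
    · refine (mul_le_mul' hQ le_rfl).trans ((m.fil_mul_fil_le le_rfl (by omega)).trans ?_)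
      exact le_sup_of_le_right (m.fil_antitone (by omega))
    · rw [Submodule.mul_sup]
      refine sup_le ((hP 2 (by omega)).trans ?_)
        ((m.fil_mul_fil_le (by omega) (by omega)).trans ?_)
      · exact le_sup_of_le_right (m.fil_antitone (by omega))
      · exact le_sup_of_le_right (m.fil_antitone (by omega))

theorem reading_le (v : V) (w : List V) :
    m.reading (v :: w) ≤ throughCharacters ((v :: w).map m.character) := by
  induction w generalizing v with
  | nil =>
    change _ ≤ otherKernel (m.character v)
    rw [m.otherKernel_eq, reading, Submodule.span_le]
    rintro _ ⟨x, hx, rfl⟩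
    have hx : x.label = v := by simpa [Pos.word] using hx
    refine Submodule.mem_sup_left (Submodule.subset_span ?_)
    rw [← hx]
    exact if_pos rfl
  | cons v' w ih =>
    change _ ≤ otherKernel (m.character v) * characterKernel K T *
      throughCharacters ((v' :: w).map m.character)
    rw [reading, Submodule.span_le]
    rintro _ ⟨x, hx, rfl⟩
    simp only [List.length_cons] at hx
    rw [Pos.word_succ] at hx
    obtain ⟨hx, hx'⟩ := List.cons_eq_cons.1 hx
    -- The arc is split after its first step to match the recursive definition of the product; if
    -- `w` is empty, the last factor is an idempotent.
    have h1 : m.e v * m.arc x 1 * m.arcOrIdem x.next w.length =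
        m.arcOrIdem x ((v :: v' :: w).length - 1) := by
      rw [← hx, m.e_mul_arc x 1 le_rfl, m.arcOrIdem_of_pos x (by simp)]
      rcases Nat.eq_zero_or_pos w.length with hw | hw
      · simp only [hw, List.length_cons, arcOrIdem, if_pos]
        exact m.arc_mul_e x 1 le_rfl
      · rw [m.arcOrIdem_of_pos _ hw]
        refine (m.arc_mul_arc x 1 w.length le_rfl hw).trans ?_
        simp [add_comm]
    rw [← h1]
    refine Submodule.mul_mem_mul (Submodule.mul_mem_mul ?_ ?_)
      (ih v' (Submodule.subset_span ⟨x.next, hx', rfl⟩))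
    · rw [m.otherKernel_eq]
      exact Submodule.mem_sup_left (Submodule.mem_span_singleton_self _)
    · rw [m.characterKernel_eq]
      exact m.arc_mem_fil x le_rfl

/-- The indices of the socle elements and of the arcs of length at least `k`. -/
def filIndex (c : ι → List V) (k : ℕ) : Set (ArcIndex c) :=
  {i | (∃ v, i = .inr (.inl v)) ∨ ∃ (x : Pos c) (j : Fin (x.per - 1)),
    k ≤ j + 1 ∧ i = .inr (.inr ⟨x, j⟩)}

/-- The indices of the proper arcs along which a given word is read. -/
def readingIndex (c : ι → List V) (w : List V) : Set (ArcIndex c) :=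
  {i | ∃ (x : Pos c) (j : Fin (x.per - 1)),
    (j : ℕ) + 1 = w.length - 1 ∧ Pos.word w.length x = w ∧ i = .inr (.inr ⟨x, j⟩)}

/-- A full turn on a cycle shorter than `k` need not lie in the `k`-th power. Adding the annihilator
includes all full turns, so the space is spanned by basis elements whatever the lengths of the
cycles. -/
theorem kernelFiltration_eq {k : ℕ} (hk : 1 ≤ k) :
    kernelFiltration K T k = Submodule.span K (m.basis '' filIndex c k) := by
  rw [kernelFiltration, m.characterKernel_pow hk, m.kernelAnnihilator_eq]
  refine le_antisymm (sup_le ?_ ?_) ?_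
  · rw [fil, Submodule.span_le]
    rintro _ ⟨x, l, hl, rfl⟩
    rcases m.arc_eq x (hk.trans hl) with ⟨i, rfl, h⟩ | ⟨-, h⟩ | ⟨-, h⟩
    · rw [h]
      exact Submodule.subset_span ⟨_, Or.inr ⟨x, i, hl, rfl⟩, rfl⟩
    · rw [h]
      exact Submodule.subset_span ⟨_, Or.inl ⟨_, rfl⟩, rfl⟩
    · rw [h]
      exact zero_mem _
  · rw [socle, Submodule.span_le]
    rintro _ ⟨v, rfl⟩
    exact Submodule.subset_span ⟨_, Or.inl ⟨_, rfl⟩, rfl⟩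
  · rw [Submodule.span_le]
    rintro _ ⟨_, ⟨v, rfl⟩ | ⟨x, j, hj, rfl⟩, rfl⟩
    · exact Submodule.mem_sup_right (Submodule.subset_span ⟨v, rfl⟩)
    · rw [← m.arc_lt]
      exact Submodule.mem_sup_left (m.arc_mem_fil x hj)

/-- Modulo the filtration the upper and lower bounds for the product coincide. Readings that make a
full turn are absorbed by the socle, and only those along proper arcs remain. -/
theorem throughCharacters_sup {w : List V} (hw : 2 ≤ w.length) :
    throughCharacters (w.map m.character) ⊔ kernelFiltration K T w.length =
      Submodule.span K (m.basis '' (filIndex c w.length ∪ readingIndex c w)) := by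
  have hk : 1 ≤ w.length := by omega
  have h1 : throughCharacters (w.map m.character) ⊔ kernelFiltration K T w.length =
      m.reading w ⊔ kernelFiltration K T w.length := by
    have hf : m.fil w.length ≤ kernelFiltration K T w.length := by
      rw [kernelFiltration, m.characterKernel_pow hk]
      exact le_sup_left
    obtain ⟨v, w, rfl⟩ := List.exists_cons_of_length_pos hk
    refine le_antisymm (sup_le ((m.throughCharacters_le v w).trans ?_) le_sup_right)
      (sup_le_sup_right (m.reading_le v w) _)
    exact sup_le_sup_left hf _
  rw [h1, Set.image_union, Submodule.span_union, ← m.kernelFiltration_eq hk, sup_comm]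
  refine le_antisymm (sup_le le_sup_left ?_) (sup_le_sup_left ?_ _)
  · rw [reading, Submodule.span_le]
    rintro _ ⟨x, hx, rfl⟩
    have hl : 1 ≤ w.length - 1 := by omega
    rw [m.arcOrIdem_of_pos x hl]
    rcases m.arc_eq x hl with ⟨i, hi, h⟩ | ⟨-, h⟩ | ⟨-, h⟩
    · rw [h]
      exact Submodule.mem_sup_right (Submodule.subset_span ⟨_, ⟨x, i, hi.symm, hx, rfl⟩, rfl⟩)
    · rw [h, m.kernelFiltration_eq hk]
      exact Submodule.mem_sup_left (Submodule.subset_span ⟨_, Or.inl ⟨_, rfl⟩, rfl⟩)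
    · rw [h]
      exact zero_mem _
  · rw [Submodule.span_le]
    rintro _ ⟨_, ⟨x, j, hj, hx, rfl⟩, rfl⟩
    rw [← m.arc_lt, hj]
    exact Submodule.subset_span ⟨x, hx, (m.arcOrIdem_of_pos x (by omega)).symm⟩

theorem finrank_span_image {n M : Type*} [AddCommGroup M] [Module K M] [Finite n]
    (b : Basis n K M) (A : Set n) : finrank K (Submodule.span K (b '' A)) = A.ncard := by
  classical
  have := Fintype.ofFinite A
  have h := finrank_span_eq_card (b.linearIndependent.comp ((↑) : A → n) Subtype.val_injective)
  rw [Set.range_comp, Subtype.range_coe] at h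
  rw [h, ← Nat.card_eq_fintype_card, Nat.card_coe_set_eq]

theorem ncard_readingIndex {ι V : Type*} {c : ι → List V} {w : List V} (hw : 2 ≤ w.length) :
    (readingIndex c w).ncard = Pos.count c w := by
  rw [Pos.count, ← Nat.card_coe_set_eq]
  let f : {x : Pos c // w.length ≤ x.per ∧ Pos.word w.length x = w} → readingIndex c w :=
    -- A word of `n` letters is read along an arc of length `n - 1`, whose index is `n - 2`; this is
    -- a valid index exactly when `n` does not exceed the length of the cycle.
    fun x => ⟨.inr (.inr ⟨x.1, ⟨w.length - 2, by have := x.2.1; omega⟩⟩),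
      x.1, ⟨w.length - 2, by have := x.2.1; omega⟩, by simp only; omega, x.2.2, rfl⟩
  refine (Nat.card_congr (Equiv.ofBijective f ⟨fun x y h => ?_, ?_⟩)).symm
  · have := congrArg Subtype.val h
    simp only [f, Sum.inr.injEq, Sigma.mk.injEq] at this
    exact Subtype.ext this.1
  · rintro ⟨_, x, j, hj, hx, rfl⟩
    have hj' := j.2
    refine ⟨⟨x, by omega, hx⟩, Subtype.ext ?_⟩
    simp only [f, Sum.inr.injEq, Sigma.mk.injEq, heq_eq_eq, true_and]
    exact Fin.ext (by simp only; omega)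

theorem finrank_throughCharacters [Finite ι] {w : List V} (hw : 2 ≤ w.length) :
    finrank K ↥(throughCharacters (w.map m.character) ⊔ kernelFiltration K T w.length) =
      finrank K (kernelFiltration K T w.length) + Pos.count c w := by
  rw [m.throughCharacters_sup hw, m.kernelFiltration_eq (by omega), finrank_span_image,
    finrank_span_image, ← ncard_readingIndex hw]
  refine Set.ncard_union_eq ?_
  rw [Set.disjoint_left]
  rintro _ (⟨v, rfl⟩ | ⟨x, j, hj, rfl⟩) ⟨y, i, hi, -, h⟩
  · simp at h
  · simp only [Sum.inr.injEq] at h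
    cases h
    omega

/-- Both presentations belong to the same algebra, so both alphabets are identified with its set of
characters, and the dimensions that give the counts refer only to these characters. -/
theorem exists_equiv_count_eq {κ W : Type*} [Fintype W] [Finite ι] [Finite κ] {c' : κ → List W}
    (m : ArcBasis K T c) (m' : ArcBasis K T c') :
    ∃ ε : V ≃ W, ∀ w : List V, 2 ≤ w.length → Pos.count c w = Pos.count c' (w.map ε) := by
  let f := Equiv.ofBijective _ m.character_bijective
  let g := Equiv.ofBijective _ m'.character_bijective
  refine ⟨f.trans g.symm, fun w hw => ?_⟩
  have hχ : (w.map (f.trans g.symm)).map m'.character = w.map m.character := by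
    rw [List.map_map]
    exact List.map_congr_left fun v _ => g.apply_symm_apply (f v)
  have h1 := m.finrank_throughCharacters hw
  have h2 := m'.finrank_throughCharacters (w := w.map (f.trans g.symm)) (by simpa using hw)
  rw [hχ, List.length_map] at h2
  omega

end ArcBasis

/-! ### Paths as lists of arrows -/

/-- An arrow of a quiver, together with its source and its target. -/
abbrev QArrow (V : Type*) [Quiver V] : Type _ := Σ u v : V, u ⟶ v

/-- The list of the arrows of a path. -/
def pathArrows {V : Type*} [Quiver V] {u : V} : ∀ {v : V}, Quiver.Path u v → List (QArrow V)
  | _, .nil => []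
  | _, .cons p a => pathArrows p ++ [⟨_, _, a⟩]

namespace QPath

variable {V : Type*} [Quiver V]

/-- The list of the arrows of a path. -/
def arrows (p : QPath V) : List (QArrow V) := pathArrows p.2.2

/-- The path formed by a path and an arrow. -/
def snoc (p : QPath V) {w : V} (a : p.tgt ⟶ w) : QPath V := ⟨p.src, w, p.2.2.cons a⟩

@[simp] theorem arrows_triv (v : V) : (triv v).arrows = [] := rfl

@[simp] theorem arrows_arrow {u v : V} (a : u ⟶ v) : (arrow a).arrows = [⟨u, v, a⟩] := rfl

@[simp] theorem arrows_snoc (p : QPath V) {w : V} (a : p.tgt ⟶ w) :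
    (p.snoc a).arrows = p.arrows ++ [⟨_, _, a⟩] := rfl

@[simp] theorem len_arrow {u v : V} (a : u ⟶ v) : (arrow a).len = 1 := rfl

theorem snoc_eq_comp (p : QPath V) {w : V} (a : p.tgt ⟶ w) : p.snoc a = p.comp (arrow a) rfl :=
  rfl

@[elab_as_elim]
theorem snocRec {P : QPath V → Prop} (h0 : ∀ v, P (triv v))
    (hs : ∀ (p : QPath V) (w : V) (a : p.tgt ⟶ w), P p → P (p.snoc a)) (p : QPath V) : P p := by
  obtain ⟨u, v, p⟩ := p
  induction p with
  | nil => exact h0 u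
  | cons p a ih => exact hs ⟨u, _, p⟩ _ a ih

@[simp] theorem arrows_comp (p q : QPath V) (h : p.tgt = q.src) :
    (p.comp q h).arrows = p.arrows ++ q.arrows := by
  obtain ⟨a, b, p⟩ := p
  obtain ⟨c, d, q⟩ := q
  dsimp only [src, tgt] at h
  subst h
  induction q with
  | nil => simp [comp, arrows, pathArrows]
  | cons q e ih =>
    simp only [comp, arrows, Quiver.Path.cast_rfl_rfl, Quiver.Path.comp_cons, pathArrows] at ih ⊢
    rw [ih, List.append_assoc]

@[simp] theorem length_arrows (p : QPath V) : p.arrows.length = p.len := by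
  induction p using snocRec with
  | h0 v => rfl
  | hs p w a ih =>
    rw [arrows_snoc, List.length_append, ih]
    rfl

theorem verts_eq (p : QPath V) : p.verts = p.src :: p.arrows.map fun a => a.2.1 := by
  induction p using snocRec with
  | h0 v => rfl
  | hs p w a ih =>
    rw [arrows_snoc, List.map_append, ← List.cons_append]
    change p.2.2.vertices.concat w = p.src :: _ ++ [w]
    rw [List.concat_eq_append]
    exact congrArg (· ++ [w]) ih

theorem length_verts (p : QPath V) : p.verts.length = p.len + 1 := by
  rw [verts_eq, List.length_cons, List.length_map, length_arrows]

theorem eq_triv_of_arrows (p : QPath V) (h : p.arrows = []) : p = triv p.src := by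
  obtain ⟨u, v, p⟩ := p
  cases p with
  | nil => rfl
  | cons p a => exact absurd h (by simp [arrows, pathArrows])

theorem eq_snoc_of_arrows {p : QPath V} {l : List (QArrow V)} {a : QArrow V}
    (h : p.arrows = l ++ [a]) :
    ∃ (q : QPath V) (hq : q.tgt = a.1), q.src = p.src ∧ q.arrows = l ∧
      p = q.comp (arrow a.2.2) hq := by
  obtain ⟨u, v, p⟩ := p
  cases p with
  | nil => exact absurd h (by simp [arrows, pathArrows])
  | @cons w _ p b =>
    obtain ⟨rfl, h'⟩ := List.append_inj' h rfl
    rw [List.singleton_inj] at h'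
    subst h'
    exact ⟨⟨u, w, p⟩, rfl, rfl, rfl, rfl⟩

theorem ext_arrows {p q : QPath V} (hs : p.src = q.src) (ha : p.arrows = q.arrows) : p = q := by
  induction p using snocRec generalizing q with
  | h0 v =>
    rw [eq_triv_of_arrows q ha.symm]
    exact congrArg triv hs
  | hs p w a ih =>
    rw [arrows_snoc] at ha
    obtain ⟨r, hr, hrs, hra, rfl⟩ := eq_snoc_of_arrows ha.symm
    obtain rfl := ih (q := r) (hs.trans hrs.symm) hra.symm
    rfl

theorem src_eq_of_arrows {p : QPath V} {l : List (QArrow V)} {a : QArrow V}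
    (h : p.arrows = a :: l) : p.src = a.1 := by
  induction p using snocRec generalizing l a with
  | h0 v => simp at h
  | hs p w b ih =>
    rw [arrows_snoc] at h
    rcases hp : p.arrows with _ | ⟨a', l'⟩
    · rw [hp, List.nil_append, List.cons_eq_cons] at h
      rw [← h.1]
      have : p.src = p.tgt := by
        have := eq_triv_of_arrows p hp
        rw [this]
        rfl
      exact this
    · rw [hp, List.cons_append, List.cons_eq_cons] at h
      exact (ih hp).trans (congrArg Sigma.fst h.1)

theorem tgt_eq_of_arrows {p : QPath V} {l : List (QArrow V)} {a : QArrow V}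
    (h : p.arrows = l ++ [a]) : p.tgt = a.2.1 := by
  obtain ⟨q, hq, -, -, rfl⟩ := eq_snoc_of_arrows h
  rfl

theorem ext_arrows_of_ne_nil {p q : QPath V} (ha : p.arrows = q.arrows) (hn : p.arrows ≠ []) :
    p = q := by
  obtain ⟨a, l, h⟩ := List.exists_cons_of_ne_nil hn
  exact ext_arrows ((src_eq_of_arrows h).trans (src_eq_of_arrows (ha ▸ h)).symm) ha

theorem len_comp (p q : QPath V) (h : p.tgt = q.src) : (p.comp q h).len = p.len + q.len := by
  rw [← length_arrows, arrows_comp, List.length_append, length_arrows, length_arrows]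

theorem verts_comp_getElem? (p q : QPath V) (h : p.tgt = q.src) :
    (p.comp q h).verts[p.len]? = some q.src := by
  rw [verts_eq, arrows_comp]
  change (p.src :: _)[p.len]? = _
  rw [List.map_append, ← List.cons_append, ← verts_eq]
  rcases List.eq_nil_or_concat p.arrows with hp | ⟨l, a, hp⟩
  · rw [List.getElem?_append_left (by rw [length_verts]; omega), verts_eq, hp]
    have : p.len = 0 := by rw [← length_arrows, hp]; rfl
    rw [this, ← h, eq_triv_of_arrows p hp]
    rfl
  · rw [List.getElem?_append_left (by rw [length_verts]; omega), verts_eq, hp, ← h]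
    rw [List.concat_eq_append] at hp
    have : p.len = l.length + 1 := by rw [← length_arrows, hp]; simp
    rw [this, tgt_eq_of_arrows hp]
    simp

theorem exists_eq_comp (p : QPath V) {n : ℕ} (hn : n ≤ p.len) :
    ∃ (q r : QPath V) (h : q.tgt = r.src), p = q.comp r h ∧ q.len = n := by
  obtain ⟨a, b, p⟩ := p
  obtain ⟨v, q, r, rfl, hq⟩ := p.exists_eq_comp_of_le_length hn
  exact ⟨⟨a, v, q⟩, ⟨v, b, r⟩, rfl, by simp [comp], hq⟩

/-- The bound stands under the existential quantifier so that the chosen subpath is a total function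
of `i` and `l`; out of range any path will do. -/
theorem exists_sub (p : QPath V) (i l : ℕ) : ∃ q : QPath V, i + l ≤ p.len →
    q.arrows = (p.arrows.drop i).take l ∧ p.verts[i]? = some q.src ∧
      p.verts[i + l]? = some q.tgt ∧ ∃ (q₁ q₂ : QPath V) (h₁ : q₁.tgt = q.src)
        (h₂ : q.tgt = q₂.src), p = q₁.comp (q.comp q₂ h₂) h₁ := by
  by_cases h : i + l ≤ p.len
  · obtain ⟨q₁, r, h₁, rfl, rfl⟩ := p.exists_eq_comp (n := i) (by omega)
    rw [len_comp] at h
    obtain ⟨q, q₂, h₂, rfl, rfl⟩ := r.exists_eq_comp (n := l) (by omega)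
    refine ⟨q, fun _ => ⟨?_, verts_comp_getElem? _ _ _, ?_, q₁, q₂, h₁, h₂, rfl⟩⟩
    · rw [← length_arrows, ← length_arrows]
      simp
    · have e : q₁.comp (q.comp q₂ h₂) h₁ = (q₁.comp q h₁).comp q₂ h₂ :=
        (comp_assoc q₁ q q₂ h₁ h₂).symm
      rw [e, ← len_comp q₁ q h₁, h₂]
      exact verts_comp_getElem? (q₁.comp q h₁) q₂ h₂
  · exact ⟨p, fun h' => absurd h' h⟩

/-- The subpath of length `l` which starts after `i` arrows. -/
def sub (p : QPath V) (i l : ℕ) : QPath V := (p.exists_sub i l).choose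

section Sub

variable {p : QPath V} {i l : ℕ} (h : i + l ≤ p.len)

include h

theorem arrows_sub : (p.sub i l).arrows = (p.arrows.drop i).take l :=
  ((p.exists_sub i l).choose_spec h).1

theorem verts_src_sub : p.verts[i]? = some (p.sub i l).src :=
  ((p.exists_sub i l).choose_spec h).2.1

theorem verts_tgt_sub : p.verts[i + l]? = some (p.sub i l).tgt :=
  ((p.exists_sub i l).choose_spec h).2.2.1

theorem eq_comp_sub : ∃ (q₁ q₂ : QPath V) (h₁ : q₁.tgt = (p.sub i l).src)
    (h₂ : (p.sub i l).tgt = q₂.src), p = q₁.comp ((p.sub i l).comp q₂ h₂) h₁ :=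
  ((p.exists_sub i l).choose_spec h).2.2.2

theorem len_sub : (p.sub i l).len = l := by
  rw [← length_arrows, arrows_sub h, List.length_take, List.length_drop, length_arrows]
  omega

theorem head?_arrows_sub (hl : 1 ≤ l) : (p.sub i l).arrows.head? = p.arrows[i]? := by
  rw [arrows_sub h, List.head?_eq_getElem?, List.getElem?_take_of_lt hl, List.getElem?_drop,
    add_zero]

theorem getLast?_arrows_sub (hl : 1 ≤ l) :
    (p.sub i l).arrows.getLast? = p.arrows[i + l - 1]? := by
  rw [List.getLast?_eq_getElem?, length_arrows, len_sub h, arrows_sub h,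
    List.getElem?_take_of_lt (by omega), List.getElem?_drop]
  congr 1
  omega

end Sub

theorem tgt_sub_eq {p : QPath V} {i l k : ℕ} (h : i + l + k ≤ p.len) :
    (p.sub i l).tgt = (p.sub (i + l) k).src :=
  Option.some_injective _ ((verts_tgt_sub (by omega)).symm.trans (verts_src_sub h))

theorem sub_comp_sub {p : QPath V} {i l k : ℕ} (h : i + l + k ≤ p.len) :
    (p.sub i l).comp (p.sub (i + l) k) (tgt_sub_eq h) = p.sub i (l + k) := by
  refine ext_arrows (Option.some_injective _ ((verts_src_sub (by omega)).symm.trans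
    (verts_src_sub (by omega)))) ?_
  rw [arrows_comp, arrows_sub (by omega), arrows_sub h, arrows_sub (by omega), List.take_add,
    List.drop_drop]

theorem sub_zero_eq {p : QPath V} {i : ℕ} (h : i ≤ p.len) :
    p.sub i 0 = triv (p.sub i 0).src :=
  eq_triv_of_arrows _ (by rw [arrows_sub (by simpa using h), List.take_zero])

end QPath

/-- When successors are unique, a chain that cannot be prolonged is determined by its first element.
-/
theorem eq_of_isChain_of_head? {α : Type*} {r : α → α → Prop}
    (hr : ∀ a b b', r a b → r a b' → b = b') {l l' : List α} (hl : l.IsChain r)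
    (hl' : l'.IsChain r) (hh : l.head? = l'.head?) (he : ∀ a ∈ l.getLast?, ∀ b, ¬ r a b)
    (he' : ∀ a ∈ l'.getLast?, ∀ b, ¬ r a b) : l = l' := by
  induction l generalizing l' with
  | nil =>
    cases l' with
    | nil => rfl
    | cons a l' => simp at hh
  | cons a l ih =>
    cases l' with
    | nil => simp at hh
    | cons a' l' =>
      obtain rfl : a = a' := by simpa using hh
      congr 1
      rcases l with _ | ⟨b, l⟩
      · rcases l' with _ | ⟨b', l'⟩
        · rfl
        · exact absurd (List.isChain_cons_cons.1 hl').1 (he a (by simp) b')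
      · rcases l' with _ | ⟨b', l'⟩
        · exact absurd (List.isChain_cons_cons.1 hl).1 (he' a (by simp) b)
        · rw [List.isChain_cons_cons] at hl hl'
          refine ih hl.2 hl'.2 (by simp [hr a b b' hl.1 hl'.1]) ?_ ?_
          · rwa [List.getLast?_cons_cons] at he
          · rwa [List.getLast?_cons_cons] at he'

/-! ### Nonzero paths of an almost gentle algebra -/

section Ideal

variable {K V : Type*} [Field K] [Quiver V]

namespace PathAlgebra

theorem of_mul_of_comp (p q : QPath V) (h : p.tgt = q.src) :
    of K p * of K q = of K (p.comp q h) := by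
  rw [of_mul_of, mulPath_of_eq p q h]

theorem of_mul_of_ne {p q : QPath V} (h : p.tgt ≠ q.src) : of K p * of K q = 0 := by
  rw [of_mul_of, mulPath_of_ne p q h]

variable (K) in
/-- The coefficient of a path as a linear functional. -/
def coeffLinear (p : QPath V) : PathAlgebra K V →ₗ[K] K where
  toFun x := coeff x p
  map_add' _ _ := rfl
  map_smul' _ _ := rfl

theorem coeffLinear_apply (p : QPath V) (x : PathAlgebra K V) : coeffLinear K p x = coeff x p :=
  rfl

theorem coeff_of_self (p : QPath V) : coeff (of K p) p = 1 := Finsupp.single_eq_same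

theorem coeff_of_ne {p q : QPath V} (h : p ≠ q) : coeff (of K p) q = 0 :=
  Finsupp.single_eq_of_ne h.symm

theorem span_range_of : Submodule.span K (Set.range (of K (V := V))) = ⊤ := by
  rw [eq_top_iff]
  intro x _
  refine induction (P := fun x => x ∈ Submodule.span K (Set.range (of K (V := V)))) x
    (zero_mem _) (fun x y => add_mem) fun k p => Submodule.smul_mem _ _ ?_
  exact Submodule.subset_span ⟨p, rfl⟩

end PathAlgebra

open PathAlgebra

variable [Fintype V] {I : TwoSidedIdeal (PathAlgebra K V)}

theorem of_comp_mem_left {p q : QPath V} (h : p.tgt = q.src) (hp : of K p ∈ I) :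
    of K (p.comp q h) ∈ I := by
  rw [← of_mul_of_comp]
  exact I.mul_mem_right _ _ hp

theorem of_comp_mem_right {p q : QPath V} (h : p.tgt = q.src) (hq : of K q ∈ I) :
    of K (p.comp q h) ∈ I := by
  rw [← of_mul_of_comp]
  exact I.mul_mem_left _ _ hq

variable (I) in
/-- The arrow `a` is followed by the arrow `b` with a nonzero product. -/
def Link (a b : QArrow V) : Prop :=
  ∃ h : (QPath.arrow a.2.2).tgt = (QPath.arrow b.2.2).src, of K ((QPath.arrow a.2.2).comp (QPath.arrow b.2.2) h) ∉ I

theorem isChain_of_notMem {p : QPath V} (hp : of K p ∉ I) : p.arrows.IsChain (Link I) := by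
  induction p using QPath.snocRec with
  | h0 v => exact List.isChain_nil
  | hs p w a ih =>
    rw [QPath.snoc_eq_comp] at hp
    rw [QPath.arrows_snoc, List.isChain_append]
    refine ⟨ih fun h => hp (of_comp_mem_left _ h), List.isChain_singleton _, fun x hx y hy => ?_⟩
    obtain rfl : (⟨_, _, a⟩ : QArrow V) = y := by simpa using hy
    obtain ⟨l, hl⟩ := List.getLast?_eq_some_iff.1 hx
    obtain ⟨q, hq, -, -, rfl⟩ := QPath.eq_snoc_of_arrows hl
    refine ⟨rfl, fun h => hp ?_⟩
    rw [QPath.comp_assoc q _ _ hq rfl]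
    exact of_comp_mem_right _ h

/-- The span of the paths which contain a vanishing pair of consecutive arrows. -/
def brokenSpan (I : TwoSidedIdeal (PathAlgebra K V)) : Submodule K (PathAlgebra K V) :=
  Submodule.span K (of K '' {p | ¬ p.arrows.IsChain (Link I)})

/-- Composing with another path keeps the vanishing pair of consecutive arrows. -/
theorem mul_mem_brokenSpan (x : PathAlgebra K V) {y : PathAlgebra K V} (hy : y ∈ brokenSpan I) :
    x * y ∈ brokenSpan I := by
  refine induction (P := fun x => x * y ∈ brokenSpan I) x (by rw [zero_mul]; exact zero_mem _)
    (fun x x' h h' => by rw [add_mul]; exact add_mem h h') fun k p => ?_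
  rw [smul_mul_assoc]
  refine Submodule.smul_mem _ _ ?_
  have : brokenSpan I ≤ (brokenSpan I).comap (LinearMap.mulLeft K (of K p)) := by
    conv_lhs => rw [brokenSpan]
    rw [Submodule.span_le]
    rintro _ ⟨q, hq, rfl⟩
    change of K p * of K q ∈ brokenSpan I
    by_cases h : p.tgt = q.src
    · rw [of_mul_of_comp _ _ h]
      refine Submodule.subset_span ⟨_, fun hc => hq ?_, rfl⟩
      rw [QPath.arrows_comp, List.isChain_append] at hc
      exact hc.2.1
    · rw [of_mul_of_ne h]
      exact zero_mem _
  exact this hy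

theorem mem_brokenSpan_mul {x : PathAlgebra K V} (y : PathAlgebra K V) (hx : x ∈ brokenSpan I) :
    x * y ∈ brokenSpan I := by
  refine induction (P := fun y => x * y ∈ brokenSpan I) y (by rw [mul_zero]; exact zero_mem _)
    (fun x x' h h' => by rw [mul_add]; exact add_mem h h') fun k p => ?_
  rw [mul_smul_comm]
  refine Submodule.smul_mem _ _ ?_
  have : brokenSpan I ≤ (brokenSpan I).comap (LinearMap.mulRight K (of K p)) := by
    conv_lhs => rw [brokenSpan]
    rw [Submodule.span_le]
    rintro _ ⟨q, hq, rfl⟩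
    change of K q * of K p ∈ brokenSpan I
    by_cases h : q.tgt = p.src
    · rw [of_mul_of_comp _ _ h]
      refine Submodule.subset_span ⟨_, fun hc => hq ?_, rfl⟩
      rw [QPath.arrows_comp, List.isChain_append] at hc
      exact hc.1
    · rw [of_mul_of_ne h]
      exact zero_mem _
  exact this hx

theorem coeff_brokenSpan {x : PathAlgebra K V} (hx : x ∈ brokenSpan I) {p : QPath V}
    (hp : p.arrows.IsChain (Link I)) : coeff x p = 0 := by
  have : brokenSpan I ≤ LinearMap.ker (coeffLinear K p) := by
    rw [brokenSpan, Submodule.span_le]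
    rintro _ ⟨q, hq, rfl⟩
    exact coeff_of_ne fun h => hq (h ▸ hp)
  exact this hx

namespace IsAlmostGentle

variable (hI : IsAlmostGentle I)

include hI

/-- The span of the broken paths is a two-sided ideal, and it contains the generators: a path of
length two in `I` is itself a vanishing pair. -/
theorem mem_brokenSpan {x : PathAlgebra K V} (hx : x ∈ I) : x ∈ brokenSpan I := by
  obtain ⟨S, hS, hIS⟩ := hI.generated
  let J : TwoSidedIdeal (PathAlgebra K V) := TwoSidedIdeal.mk' (brokenSpan I) (zero_mem _)
    (fun h h' => add_mem h h') (fun h => neg_mem h) (fun h => mul_mem_brokenSpan _ h)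
    (fun h => mem_brokenSpan_mul _ h)
  have hJ : I ≤ J := by
    conv_lhs => rw [hIS]
    rw [TwoSidedIdeal.span_le]
    rintro _ ⟨p, hp, rfl⟩
    refine (TwoSidedIdeal.mem_mk' _ _ _ _ _ _ _).2 (Submodule.subset_span ⟨p, fun hc => ?_, rfl⟩)
    have hpI : of K p ∈ I := by
      rw [hIS]
      exact TwoSidedIdeal.subset_span ⟨p, hp, rfl⟩
    have hl := hS p hp
    rw [← QPath.length_arrows, List.length_eq_two] at hl
    obtain ⟨a, b, hab⟩ := hl
    rw [hab, List.isChain_pair] at hc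
    obtain ⟨h, hc⟩ := hc
    refine hc ?_
    have : p = (QPath.arrow a.2.2).comp (QPath.arrow b.2.2) h :=
      QPath.ext_arrows_of_ne_nil (by rw [hab]; simp) (by rw [hab]; simp)
    rwa [← this]
  exact (TwoSidedIdeal.mem_mk' _ _ _ _ _ _ _).1 (hJ hx)

theorem coeff_eq_zero {x : PathAlgebra K V} (hx : x ∈ I) {p : QPath V} (hp : of K p ∉ I) :
    coeff x p = 0 :=
  coeff_brokenSpan (hI.mem_brokenSpan hx) (isChain_of_notMem hp)

/-- An unbroken path has coefficient zero in every element of `I`, so it cannot lie in `I` itself.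
Membership of a path is thus decided by its consecutive pairs of arrows. -/
theorem notMem_iff {p : QPath V} : of K p ∉ I ↔ p.arrows.IsChain (Link I) := by
  refine ⟨isChain_of_notMem, fun h hp => ?_⟩
  have := coeff_brokenSpan (hI.mem_brokenSpan hp) h
  rw [coeff_of_self] at this
  exact one_ne_zero this

theorem triv_notMem (v : V) : of K (QPath.triv v) ∉ I :=
  hI.notMem_iff.2 List.isChain_nil

theorem arrow_notMem {u v : V} (a : u ⟶ v) : of K (QPath.arrow a) ∉ I :=
  hI.notMem_iff.2 (List.isChain_singleton _)

theorem link_right_unique (a b b' : QArrow V) (h : Link I a b) (h' : Link I a b') : b = b' := by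
  obtain ⟨u, v, a⟩ := a
  obtain ⟨v₁, w, b⟩ := b
  obtain ⟨v₂, w', b'⟩ := b'
  obtain ⟨h, hab⟩ := h
  obtain ⟨h', hab'⟩ := h'
  have hv₁ : v = v₁ := h
  have hv₂ : v = v₂ := h'
  subst hv₁
  subst hv₂
  cases hI.right_unique a ⟨w, b⟩ ⟨w', b'⟩ hab hab'
  rfl

theorem link_left_unique (a b b' : QArrow V) (h : Link I b a) (h' : Link I b' a) : b = b' := by
  obtain ⟨u, v, a⟩ := a
  obtain ⟨v₁, w, b⟩ := b
  obtain ⟨v₂, w', b'⟩ := b'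
  obtain ⟨h, hab⟩ := h
  obtain ⟨h', hab'⟩ := h'
  have hw : w = u := h
  have hw' : w' = u := h'
  subst hw
  subst hw'
  cases hI.left_unique a ⟨v₁, b⟩ ⟨v₂, b'⟩ hab hab'
  rfl

theorem not_link_head {p : QPath V} (hp : IsMaximalPath I p) {b : QArrow V}
    (hb : b ∈ p.arrows.head?) (a : QArrow V) : ¬ Link I a b := by
  intro h
  obtain ⟨l, hl⟩ := List.head?_eq_some_iff.1 hb
  have hs : (QPath.arrow a.2.2).tgt = p.src := h.1.trans (QPath.src_eq_of_arrows hl).symm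
  have h1 := hp.2.1 _ _ a.2.2
  rw [of_mul_of_comp (QPath.arrow a.2.2) p hs] at h1
  refine hI.notMem_iff.2 ?_ h1
  rw [QPath.arrows_comp, hl]
  refine List.isChain_cons_cons.2 ⟨h, ?_⟩
  rw [← hl]
  exact hI.notMem_iff.1 hp.1

theorem not_link_last {p : QPath V} (hp : IsMaximalPath I p) {a : QArrow V}
    (ha : a ∈ p.arrows.getLast?) (b : QArrow V) : ¬ Link I a b := by
  intro h
  obtain ⟨l, hl⟩ := List.getLast?_eq_some_iff.1 ha
  have hs : p.tgt = (QPath.arrow b.2.2).src := (QPath.tgt_eq_of_arrows hl).trans h.1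
  have h1 := hp.2.2 _ _ b.2.2
  rw [of_mul_of_comp p (QPath.arrow b.2.2) hs] at h1
  refine hI.notMem_iff.2 ?_ h1
  rw [QPath.arrows_comp, List.isChain_append]
  refine ⟨hI.notMem_iff.1 hp.1, List.isChain_singleton _, fun x hx y hy => ?_⟩
  obtain rfl : b = y := by simpa using hy
  obtain rfl : a = x := Option.some_injective _ (ha.symm.trans hx)
  exact h

/-- From a common arrow, successors and predecessors are unique, and a maximal path stops only where
there are none. Hence both paths agree after the arrow and before it. -/
theorem eq_of_getElem? {p q : QPath V} (hp : IsMaximalPath I p) (hq : IsMaximalPath I q)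
    {i j : ℕ} {a : QArrow V} (hi : p.arrows[i]? = some a) (hj : q.arrows[j]? = some a) :
    p = q ∧ i = j := by
  have hpc := hI.notMem_iff.1 hp.1
  have hqc := hI.notMem_iff.1 hq.1
  obtain ⟨hi', -⟩ := List.getElem?_eq_some_iff.1 hi
  obtain ⟨hj', -⟩ := List.getElem?_eq_some_iff.1 hj
  have h1 : p.arrows.drop i = q.arrows.drop j := by
    refine eq_of_isChain_of_head? hI.link_right_unique (hpc.drop i) (hqc.drop j)
      (by rw [List.head?_drop, List.head?_drop, hi, hj]) ?_ ?_
    · intro x hx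
      rw [List.getLast?_drop, if_neg (by omega)] at hx
      exact hI.not_link_last hp hx
    · intro x hx
      rw [List.getLast?_drop, if_neg (by omega)] at hx
      exact hI.not_link_last hq hx
  have h2 : p.arrows.take (i + 1) = q.arrows.take (j + 1) := by
    -- Reversal turns uniqueness of predecessors into uniqueness of successors.
    refine List.reverse_injective (eq_of_isChain_of_head? (r := fun a b => Link I b a)
      hI.link_left_unique (List.isChain_reverse.2 (hpc.take _))
      (List.isChain_reverse.2 (hqc.take _)) ?_ ?_ ?_)
    · simp [List.getLast?_take, hi, hj]
    · intro x hx
      rw [List.getLast?_reverse, List.head?_take, if_neg (by omega)] at hx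
      exact hI.not_link_head hp hx
    · intro x hx
      rw [List.getLast?_reverse, List.head?_take, if_neg (by omega)] at hx
      exact hI.not_link_head hq hx
  have h3 : i = j := by
    have := congrArg List.length h2
    simp only [List.length_take] at this
    omega
  subst h3
  refine ⟨QPath.ext_arrows_of_ne_nil ?_ (fun h => by simp [h] at hi'), rfl⟩
  have h4 := congrArg (List.take i) h2
  rw [List.take_take, List.take_take, min_eq_left (by omega)] at h4
  rw [← List.take_append_drop i p.arrows, h4, h1, List.take_append_drop]

/-- Admissibility bounds the length of nonzero paths, so a longest nonzero path containing `q`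
exists, and it is maximal. -/
theorem exists_maximalPath [∀ u v : V, Finite (u ⟶ v)] {q : QPath V} (hq : of K q ∉ I) :
    ∃ p, IsMaximalPath I p ∧ q.arrows <:+: p.arrows := by
  obtain ⟨m, -, hm⟩ := hI.admissible.1
  have hfin : {p : QPath V | of K p ∉ I ∧ q.arrows <:+: p.arrows}.Finite := by
    refine (finite_paths_le m).subset ?_
    rintro p ⟨hp, -⟩
    by_contra h
    exact hp (hm p (not_le.1 h).le)
  obtain ⟨p, ⟨hp, hqp⟩, hmax⟩ := Set.exists_max_image _ QPath.len hfin ⟨q, hq, List.infix_rfl⟩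
  refine ⟨p, ⟨hp, fun u v a => ?_, fun u v a => ?_⟩, hqp⟩
  · by_cases h : (QPath.arrow a).tgt = p.src
    · rw [of_mul_of_comp _ _ h]
      by_contra hc
      have := hmax _ ⟨hc, by
        rw [QPath.arrows_comp]
        exact hqp.trans (List.suffix_append _ _).isInfix⟩
      rw [QPath.len_comp, QPath.len_arrow] at this
      omega
    · rw [of_mul_of_ne h]
      exact zero_mem _
  · by_cases h : p.tgt = (QPath.arrow a).src
    · rw [of_mul_of_comp _ _ h]
      by_contra hc
      have := hmax _ ⟨hc, by
        rw [QPath.arrows_comp]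
        exact hqp.trans (List.prefix_append _ _).isInfix⟩
      rw [QPath.len_comp, QPath.len_arrow] at this
      omega
    · rw [of_mul_of_ne h]
      exact zero_mem _

theorem exists_eq_sub [∀ u v : V, Finite (u ⟶ v)] {q : QPath V} (hq : of K q ∉ I)
    (hn : q.arrows ≠ []) :
    ∃ p i, IsMaximalPath I p ∧ i + q.len ≤ p.len ∧ q = p.sub i q.len := by
  obtain ⟨p, hp, l, l', h⟩ := hI.exists_maximalPath hq
  have hlen : l.length + q.len ≤ p.len := by
    rw [← QPath.length_arrows, ← QPath.length_arrows, ← h]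
    simp
  refine ⟨p, l.length, hp, hlen, QPath.ext_arrows_of_ne_nil ?_ hn⟩
  rw [QPath.arrows_sub hlen, ← h, ← QPath.length_arrows]
  simp

omit hI in
theorem sub_notMem {p : QPath V} (hp : of K p ∉ I) {i l : ℕ} (h : i + l ≤ p.len) :
    of K (p.sub i l) ∉ I := by
  obtain ⟨q₁, q₂, h₁, h₂, hpq⟩ := QPath.eq_comp_sub h
  intro hm
  rw [hpq] at hp
  exact hp (of_comp_mem_right _ (of_comp_mem_left _ hm))

theorem eq_of_sub_eq {p q : QPath V} (hp : IsMaximalPath I p) (hq : IsMaximalPath I q)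
    {i j l k : ℕ} (hl : i + l ≤ p.len) (hk : j + k ≤ q.len) (hl' : 1 ≤ l) (hk' : 1 ≤ k)
    (h : (p.sub i l).arrows.head? = (q.sub j k).arrows.head?) : p = q ∧ i = j := by
  rw [QPath.head?_arrows_sub hl hl', QPath.head?_arrows_sub hk hk'] at h
  have hi : i < p.arrows.length := by
    rw [QPath.length_arrows]
    omega
  have h1 := List.getElem?_eq_getElem hi
  exact hI.eq_of_getElem? hp hq h1 (h ▸ h1)

theorem eq_of_getLast?_eq {p q : QPath V} (hp : IsMaximalPath I p) (hq : IsMaximalPath I q)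
    {i j l k : ℕ} (hl : i + l ≤ p.len) (hk : j + k ≤ q.len) (hl' : 1 ≤ l) (hk' : 1 ≤ k)
    (h : (p.sub i l).arrows.getLast? = (q.sub j k).arrows.getLast?) :
    p = q ∧ i + l = j + k := by
  rw [QPath.getLast?_arrows_sub hl hl', QPath.getLast?_arrows_sub hk hk'] at h
  have hi : i + l - 1 < p.arrows.length := by
    rw [QPath.length_arrows]
    omega
  have h1 := List.getElem?_eq_getElem hi
  obtain ⟨h2, h3⟩ := hI.eq_of_getElem? hp hq h1 (h ▸ h1)
  exact ⟨h2, by omega⟩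

/-- The last arrow of the first subpath has only one nonzero continuation. It is the next arrow of
`p`, which exists because otherwise the continuation would contradict maximality of `p`. -/
theorem eq_of_comp_sub {p q : QPath V} (hp : IsMaximalPath I p) (hq : IsMaximalPath I q)
    {i j l k : ℕ} (hl : i + l ≤ p.len) (hk : j + k ≤ q.len) (hl' : 1 ≤ l) (hk' : 1 ≤ k)
    (h : (p.sub i l).tgt = (q.sub j k).src)
    (hc : of K ((p.sub i l).comp (q.sub j k) h) ∉ I) : p = q ∧ i + l = j := by
  have hc := isChain_of_notMem hc
  rw [QPath.arrows_comp, List.isChain_append] at hc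
  have hi : i + l - 1 < p.arrows.length := by
    rw [QPath.length_arrows]
    omega
  have hj : j < q.arrows.length := by
    rw [QPath.length_arrows]
    omega
  have h1 : Link I p.arrows[i + l - 1] q.arrows[j] := by
    refine hc.2.2 _ ?_ _ ?_
    · rw [QPath.getLast?_arrows_sub hl hl']
      exact List.getElem?_eq_getElem hi
    · rw [QPath.head?_arrows_sub hk hk']
      exact List.getElem?_eq_getElem hj
  by_cases hn : i + l < p.arrows.length
  · have h2 : Link I p.arrows[i + l - 1] p.arrows[i + l] := by
      have := List.isChain_iff_getElem.1 (isChain_of_notMem hp.1) (i + l - 1) (by omega)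
      convert this using 2
      omega
    have h3 := hI.link_right_unique _ _ _ h1 h2
    exact hI.eq_of_getElem? hp hq (List.getElem?_eq_getElem hn)
      (h3 ▸ List.getElem?_eq_getElem hj)
  · refine absurd h1 (hI.not_link_last hp ?_ _)
    rw [List.getLast?_eq_getElem?]
    have : p.arrows.length - 1 = i + l - 1 := by omega
    rw [this]
    exact List.getElem?_eq_getElem hi

end IsAlmostGentle

end Ideal

open PathAlgebra

/-! ### The trivial extension in terms of paths -/

namespace DualBimodule

variable (K A : Type*) [Field K] [Ring A] [Algebra K A]

/-- The linear functionals as elements of the dual bimodule. -/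
def ofDual : Dual K A ≃ₗ[K] DualBimodule K A := LinearEquiv.refl K (A →ₗ[K] K)

variable {K A}

@[simp] theorem ofDual_apply (f : Dual K A) (x : A) : ofDual K A f x = f x := rfl

end DualBimodule

/-- The trivial extension as a product of vector spaces. -/
def trivialExtensionEquiv (K A : Type*) [Field K] [Ring A] [Algebra K A] :
    (A × DualBimodule K A) ≃ₗ[K] TrivialExtension K A where
  toFun x := TrivSqZeroExt.inl x.1 + TrivSqZeroExt.inr x.2
  invFun t := (t.fst, t.snd)
  map_add' x y := TrivSqZeroExt.ext (by simp) (by simp)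
  map_smul' k x := TrivSqZeroExt.ext (by simp) (by simp)
  left_inv x := Prod.ext (by simp) (by simp)
  right_inv t := TrivSqZeroExt.ext (by simp) (by simp)

section Elements

variable {K V : Type*} [Field K] [Quiver V] [Fintype V] {I : TwoSidedIdeal (PathAlgebra K V)}

variable (I) in
/-- The residue class of an element of the path algebra. -/
def residue : PathAlgebra K V →ₐ[K] QuotientAlgebra I := RingCon.mkₐ K I.ringCon

theorem residue_surjective : Function.Surjective (residue I) := RingCon.mkₐ_surjective I.ringCon

theorem residue_eq_iff {x y : PathAlgebra K V} : residue I x = residue I y ↔ x - y ∈ I := by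
  rw [← TwoSidedIdeal.rel_iff]
  exact RingCon.eq I.ringCon

theorem residue_eq_zero_iff {x : PathAlgebra K V} : residue I x = 0 ↔ x ∈ I := by
  rw [← map_zero (residue I), residue_eq_iff, sub_zero]

theorem residue_linearMap_ext {f g : QuotientAlgebra I →ₗ[K] K}
    (h : ∀ p : QPath V, f (residue I (of K p)) = g (residue I (of K p))) : f = g := by
  have : f ∘ₗ (residue I).toLinearMap = g ∘ₗ (residue I).toLinearMap := by
    refine LinearMap.ext_on_range (v := of K (V := V)) span_range_of h
  refine LinearMap.ext fun x => ?_
  obtain ⟨x, rfl⟩ := residue_surjective x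
  exact LinearMap.congr_fun this x

theorem residue_dualBimodule_ext {f g : DualBimodule K (QuotientAlgebra I)}
    (h : ∀ p : QPath V, f (residue I (of K p)) = g (residue I (of K p))) : f = g :=
  residue_linearMap_ext (f := (DualBimodule.ofDual _ _).symm f)
    (g := (DualBimodule.ofDual _ _).symm g) h

/-- The nonzero paths. -/
abbrev NonzeroPath (I : TwoSidedIdeal (PathAlgebra K V)) : Type _ := {p : QPath V // of K p ∉ I}

namespace IsAlmostGentle

variable (hI : IsAlmostGentle I)

include hI in
theorem linearIndependent_residue :
    LinearIndependent K fun p : NonzeroPath I => residue I (of K p.1) := by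
  rw [linearIndependent_iff']
  intro s k hk p hp
  have h1 : residue I (∑ q ∈ s, k q • of K q.1) = 0 := by
    rw [map_sum, ← hk]
    exact Finset.sum_congr rfl fun q _ => map_smul _ _ _
  have h2 := hI.coeff_eq_zero (residue_eq_zero_iff.1 h1) p.2
  rw [← coeffLinear_apply, map_sum, Finset.sum_eq_single p] at h2
  · rwa [map_smul, coeffLinear_apply, coeff_of_self, smul_eq_mul, mul_one] at h2
  · intro q _ hq
    rw [map_smul, coeffLinear_apply, coeff_of_ne (Subtype.coe_injective.ne hq), smul_zero]
  · exact fun h => absurd hp h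

/-- The basis of the nonzero paths. -/
def pathBasis : Basis (NonzeroPath I) K (QuotientAlgebra I) :=
  Basis.mk hI.linearIndependent_residue (by
    rintro x -
    obtain ⟨x, rfl⟩ := residue_surjective x
    have hx : x ∈ Submodule.span K (Set.range (of K (V := V))) := by
      rw [span_range_of]
      trivial
    have : Submodule.span K (Set.range (of K (V := V))) ≤ (Submodule.span K
        (Set.range fun p : NonzeroPath I => residue I (of K p.1))).comap
        (residue I).toLinearMap := by
      rw [Submodule.span_le]
      rintro _ ⟨p, rfl⟩
      rw [SetLike.mem_coe, Submodule.mem_comap, AlgHom.toLinearMap_apply]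
      by_cases hp : of K p ∈ I
      · rw [residue_eq_zero_iff.2 hp]
        exact zero_mem _
      · exact Submodule.subset_span ⟨⟨p, hp⟩, rfl⟩
    exact this hx)

theorem pathBasis_apply (p : NonzeroPath I) : hI.pathBasis p = residue I (of K p.1) :=
  Basis.mk_apply _ _ _

theorem pathBasis_coord_residue (p : NonzeroPath I) (x : PathAlgebra K V) :
    hI.pathBasis.coord p (residue I x) = coeff x p.1 := by
  have : hI.pathBasis.coord p ∘ₗ (residue I).toLinearMap = coeffLinear K p.1 := by
    refine LinearMap.ext_on_range (v := of K (V := V)) span_range_of fun q => ?_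
    change hI.pathBasis.coord p (residue I (of K q)) = coeff (of K q) p.1
    by_cases hq : of K q ∈ I
    · rw [residue_eq_zero_iff.2 hq, map_zero, coeff_of_ne]
      rintro rfl
      exact p.2 hq
    · have h := hI.pathBasis_apply ⟨q, hq⟩
      rw [← h]
      by_cases hpq : p = ⟨q, hq⟩
      · subst hpq
        rw [coeff_of_self]
        simp
      · rw [coeff_of_ne fun hh => hpq (Subtype.ext hh.symm)]
        simp [Ne.symm hpq]
  exact LinearMap.congr_fun this x

end IsAlmostGentle

variable (I) in
/-- A path as an element of the trivial extension. -/
def primal (p : QPath V) : TrivialExtension K (QuotientAlgebra I) :=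
  TrivSqZeroExt.inl (residue I (of K p))

theorem primal_of_mem {p : QPath V} (hp : of K p ∈ I) : primal I p = 0 := by
  rw [primal, residue_eq_zero_iff.2 hp, TrivSqZeroExt.inl_zero]

theorem primal_mul_primal (p q : QPath V) (h : p.tgt = q.src) :
    primal I p * primal I q = primal I (p.comp q h) := by
  rw [primal, primal, primal, TrivSqZeroExt.inl_mul_inl, ← map_mul, of_mul_of_comp]

theorem primal_mul_primal_of_ne {p q : QPath V} (h : p.tgt ≠ q.src) :
    primal I p * primal I q = 0 := by
  rw [primal, primal, TrivSqZeroExt.inl_mul_inl, ← map_mul, of_mul_of_ne h, map_zero,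
    TrivSqZeroExt.inl_zero]

namespace IsAlmostGentle

variable (hI : IsAlmostGentle I)

open Classical in
/-- The linear functional dual to a nonzero path. -/
def dualPath (p : QPath V) : DualBimodule K (QuotientAlgebra I) :=
  if hp : of K p ∉ I then DualBimodule.ofDual _ _ (hI.pathBasis.coord ⟨p, hp⟩) else 0

theorem dualPath_of_notMem {p : QPath V} (hp : of K p ∉ I) :
    hI.dualPath p = DualBimodule.ofDual _ _ (hI.pathBasis.coord ⟨p, hp⟩) := dif_pos hp

theorem dualPath_of_mem {p : QPath V} (hp : of K p ∈ I) : hI.dualPath p = 0 :=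
  dif_neg (not_not.2 hp)

theorem dualPath_residue {p : QPath V} (hp : of K p ∉ I) (x : PathAlgebra K V) :
    hI.dualPath p (residue I x) = coeff x p := by
  rw [hI.dualPath_of_notMem hp]
  exact hI.pathBasis_coord_residue ⟨p, hp⟩ x

/-- The linear functional dual to a nonzero path as an element of the trivial extension. -/
def dual (p : QPath V) : TrivialExtension K (QuotientAlgebra I) :=
  TrivSqZeroExt.inr (hI.dualPath p)

theorem dual_mul_dual (p q : QPath V) : hI.dual p * hI.dual q = 0 :=
  TrivSqZeroExt.inr_mul_inr _ _ _

theorem primal_mul_dual_eq {p q : QPath V} {f : DualBimodule K (QuotientAlgebra I)}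
    (hq : of K q ∉ I) (h : ∀ r, coeff (of K r * of K p) q = f (residue I (of K r))) :
    primal I p * hI.dual q = TrivSqZeroExt.inr f := by
  rw [primal, dual, TrivSqZeroExt.inl_mul_inr]
  congr 1
  refine residue_dualBimodule_ext fun r => ?_
  rw [← h]
  change hI.dualPath q (residue I (of K r) * residue I (of K p)) = _
  rw [← map_mul, hI.dualPath_residue hq]

theorem dual_mul_primal_eq {p q : QPath V} {f : DualBimodule K (QuotientAlgebra I)}
    (hq : of K q ∉ I) (h : ∀ r, coeff (of K p * of K r) q = f (residue I (of K r))) :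
    hI.dual q * primal I p = TrivSqZeroExt.inr f := by
  rw [primal, dual, TrivSqZeroExt.inr_mul_inl]
  congr 1
  refine residue_dualBimodule_ext fun r => ?_
  rw [← h]
  change hI.dualPath q (residue I (of K p) * residue I (of K r)) = _
  rw [← map_mul, hI.dualPath_residue hq]

/-- The functional `p q*` sends `r` to the coefficient of `q` in `r p`; by cancellation this is one
only for `r = x`. -/
theorem primal_mul_dual {p q x : QPath V} (h : x.tgt = p.src) (hq : x.comp p h = q)
    (hqI : of K q ∉ I) : primal I p * hI.dual q = hI.dual x := by
  have hx : of K x ∉ I := fun hx => hqI (hq ▸ of_comp_mem_left h hx)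
  refine hI.primal_mul_dual_eq hqI fun r => ?_
  rw [hI.dualPath_residue hx]
  by_cases hr : r.tgt = p.src
  · rw [of_mul_of_comp _ _ hr]
    by_cases hrx : r = x
    · subst hrx
      rw [hq, coeff_of_self, coeff_of_self]
    · rw [coeff_of_ne hrx, coeff_of_ne]
      rw [← hq]
      refine fun he => hrx (QPath.ext_arrows (show (r.comp p hr).src = (x.comp p h).src by rw [he]) ?_)
      have := congrArg QPath.arrows he
      rw [QPath.arrows_comp, QPath.arrows_comp] at this
      exact List.append_cancel_right this
  · rw [of_mul_of_ne hr, coeff_of_ne]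
    · rfl
    · rintro rfl
      exact hr h

theorem primal_mul_dual_of_ne {p q : QPath V} (h : ∀ x h, QPath.comp x p h ≠ q) :
    primal I p * hI.dual q = 0 := by
  by_cases hqI : of K q ∈ I
  · rw [dual, hI.dualPath_of_mem hqI, TrivSqZeroExt.inr_zero, mul_zero]
  · rw [← TrivSqZeroExt.inr_zero]
    refine hI.primal_mul_dual_eq hqI fun r => ?_
    rw [DualBimodule.zero_apply]
    by_cases hr : r.tgt = p.src
    · rw [of_mul_of_comp _ _ hr, coeff_of_ne (h _ _)]
    · rw [of_mul_of_ne hr]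
      rfl

theorem dual_mul_primal {p q x : QPath V} (h : p.tgt = x.src) (hq : p.comp x h = q)
    (hqI : of K q ∉ I) : hI.dual q * primal I p = hI.dual x := by
  have hx : of K x ∉ I := fun hx => hqI (hq ▸ of_comp_mem_right h hx)
  refine hI.dual_mul_primal_eq hqI fun r => ?_
  rw [hI.dualPath_residue hx]
  by_cases hr : p.tgt = r.src
  · rw [of_mul_of_comp _ _ hr]
    by_cases hrx : r = x
    · subst hrx
      rw [hq, coeff_of_self, coeff_of_self]
    · rw [coeff_of_ne hrx, coeff_of_ne]
      rw [← hq]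
      refine fun he => hrx (QPath.ext_arrows (hr.symm.trans h) ?_)
      have := congrArg QPath.arrows he
      rw [QPath.arrows_comp, QPath.arrows_comp] at this
      exact List.append_cancel_left this
  · rw [of_mul_of_ne hr, coeff_of_ne]
    · rfl
    · rintro rfl
      exact hr h

theorem dual_mul_primal_of_ne {p q : QPath V} (h : ∀ x h, QPath.comp p x h ≠ q) :
    hI.dual q * primal I p = 0 := by
  by_cases hqI : of K q ∈ I
  · rw [dual, hI.dualPath_of_mem hqI, TrivSqZeroExt.inr_zero, zero_mul]
  · rw [← TrivSqZeroExt.inr_zero]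
    refine hI.dual_mul_primal_eq hqI fun r => ?_
    rw [DualBimodule.zero_apply]
    by_cases hr : p.tgt = r.src
    · rw [of_mul_of_comp _ _ hr, coeff_of_ne (h _ _)]
    · rw [of_mul_of_ne hr]
      rfl

theorem sum_primal_triv : ∑ v : V, primal I (QPath.triv v) = 1 := by
  have h : ∑ v : V, primal I (QPath.triv v) = TrivSqZeroExt.inl (residue I 1) := by
    rw [one_def, map_sum]
    exact (map_sum (TrivSqZeroExt.inlHom (QuotientAlgebra I)
      (DualBimodule K (QuotientAlgebra I))) _ _).symm
  rw [h, map_one, TrivSqZeroExt.inl_one]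

include hI in
theorem finite_nonzeroPath [∀ u v : V, Finite (u ⟶ v)] : Finite (NonzeroPath I) := by
  obtain ⟨m, -, hm⟩ := hI.admissible.1
  refine Set.Finite.subset (finite_paths_le m) (s := {p : QPath V | p.len ≤ m}) fun p hp => ?_
  by_contra h
  exact hp (hm p (not_le.1 h).le)

open Classical in
/-- The basis of the trivial extension formed by the nonzero paths and their dual functionals. -/
def trivialExtensionBasis [∀ u v : V, Finite (u ⟶ v)] :
    Basis (NonzeroPath I ⊕ NonzeroPath I) K (TrivialExtension K (QuotientAlgebra I)) :=
  have := hI.finite_nonzeroPath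
  (hI.pathBasis.prod (hI.pathBasis.dualBasis.map (DualBimodule.ofDual _ _))).map
    (trivialExtensionEquiv K (QuotientAlgebra I))

theorem trivialExtensionBasis_inl [∀ u v : V, Finite (u ⟶ v)] (p : NonzeroPath I) :
    hI.trivialExtensionBasis (.inl p) = primal I p.1 := by
  rw [trivialExtensionBasis, Basis.map_apply]
  simp [Basis.prod_apply, trivialExtensionEquiv, primal, hI.pathBasis_apply]

theorem trivialExtensionBasis_inr [∀ u v : V, Finite (u ⟶ v)] (p : NonzeroPath I) :
    hI.trivialExtensionBasis (.inr p) = hI.dual p.1 := by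
  have := hI.finite_nonzeroPath
  rw [trivialExtensionBasis, Basis.map_apply, dual, hI.dualPath_of_notMem p.2]
  simp [Basis.prod_apply, trivialExtensionEquiv]

end IsAlmostGentle

end Elements

/-! ### The arcs of the trivial extension -/

section Arcs

variable {K V : Type*} [Field K] [Quiver V] [Fintype V] {I : TwoSidedIdeal (PathAlgebra K V)}

namespace IsAlmostGentle

variable (hI : IsAlmostGentle I)

theorem primal_triv_mul_primal {p : QPath V} {v : V} (h : v = p.src) :
    primal I (QPath.triv v) * primal I p = primal I p := by
  rw [primal_mul_primal (QPath.triv v) p h, QPath.triv_comp]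

theorem primal_mul_primal_triv {p : QPath V} {v : V} (h : p.tgt = v) :
    primal I p * primal I (QPath.triv v) = primal I p := by
  rw [primal_mul_primal p (QPath.triv v) h, QPath.comp_triv]

/-- A dual functional leads from the target of its path back to the source, so it can close the path
to a cycle. -/
theorem primal_triv_mul_dual {p : QPath V} {v : V} (hp : of K p ∉ I) (h : p.tgt = v) :
    primal I (QPath.triv v) * hI.dual p = hI.dual p :=
  hI.primal_mul_dual h (QPath.comp_triv p v h) hp

theorem dual_mul_primal_triv {p : QPath V} {v : V} (hp : of K p ∉ I) (h : v = p.src) :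
    hI.dual p * primal I (QPath.triv v) = hI.dual p :=
  hI.dual_mul_primal h (QPath.triv_comp p v h) hp

theorem primal_mul_dual_of_len {p q : QPath V} (h : q.len < p.len) :
    primal I p * hI.dual q = 0 := by
  refine hI.primal_mul_dual_of_ne fun x hx he => ?_
  rw [← he, QPath.len_comp] at h
  omega

theorem dual_mul_primal_of_len {p q : QPath V} (h : q.len < p.len) :
    hI.dual q * primal I p = 0 := by
  refine hI.dual_mul_primal_of_ne fun x hx he => ?_
  rw [← he, QPath.len_comp] at h
  omega

/-- The arc of length `l` which starts after `i` arrows of the path `p`: a subpath of `p`, or the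
functional dual to the complementary subpath. -/
def pathArc (p : QPath V) (i l : ℕ) : TrivialExtension K (QuotientAlgebra I) :=
  if i + l ≤ p.len then primal I (p.sub i l)
  else if l ≤ p.len + 1 then hI.dual (p.sub (i + l - (p.len + 1)) (p.len + 1 - l))
  else 0

theorem pathArc_of_le {p : QPath V} {i l : ℕ} (h : i + l ≤ p.len) :
    hI.pathArc p i l = primal I (p.sub i l) := if_pos h

theorem pathArc_of_lt {p : QPath V} {i l : ℕ} (h : p.len < i + l) (h' : l ≤ p.len + 1) :
    hI.pathArc p i l = hI.dual (p.sub (i + l - (p.len + 1)) (p.len + 1 - l)) := by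
  rw [pathArc, if_neg (by omega), if_pos h']

theorem pathArc_of_gt {p : QPath V} {i l : ℕ} (h : p.len + 1 < l) : hI.pathArc p i l = 0 := by
  rw [pathArc, if_neg (by omega), if_neg (by omega)]

/-- The complement of a full turn is the trivial subpath at the starting point, so the result
depends only on the vertex there and not on the path. -/
theorem pathArc_full {p : QPath V} {i : ℕ} {v : V} (hv : p.verts[i]? = some v) :
    hI.pathArc p i (p.len + 1) = hI.dual (QPath.triv v) := by
  have hi : i ≤ p.len := by
    obtain ⟨h, -⟩ := List.getElem?_eq_some_iff.1 hv
    rw [QPath.length_verts] at h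
    omega
  rw [hI.pathArc_of_lt (by omega) le_rfl, Nat.add_sub_cancel, Nat.sub_self, QPath.sub_zero_eq hi]
  congr 2
  exact Option.some_injective _ ((QPath.verts_src_sub (l := 0) hi).symm.trans hv)

theorem wrap_of_le {i l n : ℕ} (h : i + l ≤ n) : (i + l) % (n + 1) = i + l :=
  Nat.mod_eq_of_lt (by omega)

theorem wrap_of_lt {i l n : ℕ} (hi : i ≤ n) (h : n < i + l) (hl : l ≤ n + 1) :
    (i + l) % (n + 1) = i + l - (n + 1) := by
  rw [Nat.mod_eq_sub_mod (by omega), Nat.mod_eq_of_lt (by omega)]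

theorem pathArc_mul_pathArc {p : QPath V} (hp : of K p ∉ I) {i l k : ℕ} (hi : i ≤ p.len)
    (hl : 1 ≤ l) (hk : 1 ≤ k) :
    hI.pathArc p i l * hI.pathArc p ((i + l) % (p.len + 1)) k = hI.pathArc p i (l + k) := by
  rcases Nat.lt_or_ge (p.len + 1) l with hl' | hl'
  · rw [hI.pathArc_of_gt hl', zero_mul, hI.pathArc_of_gt (by omega)]
  rcases Nat.lt_or_ge (p.len + 1) k with hk' | hk'
  · rw [hI.pathArc_of_gt hk', mul_zero, hI.pathArc_of_gt (by omega)]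
  rcases Nat.lt_or_ge p.len (i + l) with h | h
  · rw [wrap_of_lt hi h hl', hI.pathArc_of_lt h hl']
    rcases Nat.lt_or_ge p.len (i + l - (p.len + 1) + k) with h₂ | h₂
    -- If both arcs cross the closing step, their total length exceeds a full turn.
    · rw [hI.pathArc_of_lt h₂ hk', dual_mul_dual, hI.pathArc_of_gt (by omega)]
    · rw [hI.pathArc_of_le h₂]
      rcases Nat.lt_or_ge (p.len + 1) (l + k) with h₃ | h₃
      · rw [hI.pathArc_of_gt h₃]
        refine hI.dual_mul_primal_of_len ?_
        rw [QPath.len_sub (by omega), QPath.len_sub (by omega)]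
        omega
      · rw [hI.pathArc_of_lt (by omega) h₃]
        -- The complement of the first arc is the second arc followed by the complement of the
        -- product; cancelling the second arc leaves the dual of the latter.
        have hc : (i + l - (p.len + 1)) + k + (p.len + 1 - (l + k)) ≤ p.len := by omega
        have e₁ : i + (l + k) - (p.len + 1) = i + l - (p.len + 1) + k := by omega
        have e₂ : p.len + 1 - l = k + (p.len + 1 - (l + k)) := by omega
        rw [e₁]
        refine hI.dual_mul_primal (QPath.tgt_sub_eq hc) ?_ (sub_notMem hp (by omega))
        rw [QPath.sub_comp_sub hc, e₂]
  · rw [wrap_of_le h, hI.pathArc_of_le h]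
    rcases Nat.lt_or_ge p.len (i + l + k) with h₂ | h₂
    · rw [hI.pathArc_of_lt h₂ hk']
      rcases Nat.lt_or_ge (p.len + 1) (l + k) with h₃ | h₃
      · rw [hI.pathArc_of_gt h₃]
        refine hI.primal_mul_dual_of_len ?_
        rw [QPath.len_sub (by omega), QPath.len_sub (by omega)]
        omega
      · rw [hI.pathArc_of_lt (by omega) h₃]
        -- Dually, the complement of the second arc is the complement of the product followed by the
        -- first arc.
        have hc : (i + (l + k) - (p.len + 1)) + (p.len + 1 - (l + k)) + l ≤ p.len := by omega
        have e₁ : (i + (l + k) - (p.len + 1)) + (p.len + 1 - (l + k)) = i := by omega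
        have e₂ : p.len + 1 - k = (p.len + 1 - (l + k)) + l := by omega
        have h₄ := QPath.sub_comp_sub hc
        have h₅ := QPath.tgt_sub_eq hc
        simp only [e₁] at h₄ h₅
        rw [e₂, add_assoc]
        refine hI.primal_mul_dual h₅ h₄ (sub_notMem hp (by omega))
    · rw [hI.pathArc_of_le h₂, hI.pathArc_of_le (by omega),
        primal_mul_primal _ _ (QPath.tgt_sub_eq h₂), QPath.sub_comp_sub h₂]

/-- A nonzero product forces one subpath to be an initial or final part of the other, or two
subpaths to compose to a nonzero path. Uniqueness of the place of an arrow then puts both arcs on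
the same cycle, one after the other. A path of length zero has only dual arcs. -/
theorem pathArc_mul_pathArc_of_ne {p q : QPath V} (hp : IsMaximalPath I p ∨ p.len = 0)
    (hq : IsMaximalPath I q ∨ q.len = 0) {i j l k : ℕ} (hi : i ≤ p.len) (hj : j ≤ q.len)
    (hl : 1 ≤ l) (hk : 1 ≤ k) (hne : ¬ (q = p ∧ j = (i + l) % (p.len + 1))) :
    hI.pathArc p i l * hI.pathArc q j k = 0 := by
  rcases Nat.lt_or_ge (p.len + 1) l with hl' | hl'
  · rw [hI.pathArc_of_gt hl', zero_mul]
  rcases Nat.lt_or_ge (q.len + 1) k with hk' | hk'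
  · rw [hI.pathArc_of_gt hk', mul_zero]
  rcases Nat.lt_or_ge p.len (i + l) with h | h <;> rcases Nat.lt_or_ge q.len (j + k) with h₂ | h₂
  · rw [hI.pathArc_of_lt h hl', hI.pathArc_of_lt h₂ hk', dual_mul_dual]
  · have hq := hq.resolve_right (by omega)
    rw [hI.pathArc_of_lt h hl', hI.pathArc_of_le h₂]
    refine hI.dual_mul_primal_of_ne fun x hx he => hne ?_
    have hlen := QPath.len_comp _ _ hx
    rw [he, QPath.len_sub (by omega), QPath.len_sub (by omega)] at hlen
    have hp := hp.resolve_right (by omega)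
    obtain ⟨h₃, h₄⟩ := hI.eq_of_sub_eq hp hq (i := i + l - (p.len + 1)) (l := p.len + 1 - l)
      (j := j) (k := k) (by omega) (by omega) (by omega) (by omega) (by
        rw [← he, QPath.arrows_comp, List.head?_append_of_ne_nil]
        intro hn
        have := congrArg List.length hn
        rw [QPath.length_arrows, QPath.len_sub (by omega), List.length_nil] at this
        omega)
    refine ⟨h₃.symm, ?_⟩
    rw [wrap_of_lt hi h hl', h₄]
  · have hp := hp.resolve_right (by omega)
    rw [hI.pathArc_of_le h, hI.pathArc_of_lt h₂ hk']
    refine hI.primal_mul_dual_of_ne fun x hx he => hne ?_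
    have hlen := QPath.len_comp _ _ hx
    rw [he, QPath.len_sub (by omega), QPath.len_sub (by omega)] at hlen
    have hq := hq.resolve_right (by omega)
    obtain ⟨h₃, h₄⟩ := hI.eq_of_getLast?_eq hp hq (i := i) (l := l)
      (j := j + k - (q.len + 1)) (k := q.len + 1 - k) (by omega) (by omega) (by omega) (by omega)
      (by
        rw [← he, QPath.arrows_comp, List.getLast?_append_of_ne_nil]
        intro hn
        have := congrArg List.length hn
        rw [QPath.length_arrows, QPath.len_sub (by omega), List.length_nil] at this
        omega)
    refine ⟨h₃.symm, ?_⟩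
    rw [wrap_of_le h]
    omega
  · have hp := hp.resolve_right (by omega)
    have hq := hq.resolve_right (by omega)
    rw [hI.pathArc_of_le h, hI.pathArc_of_le h₂]
    by_cases hc : (p.sub i l).tgt = (q.sub j k).src
    · rw [primal_mul_primal _ _ hc]
      refine primal_of_mem ?_
      by_contra hcI
      obtain ⟨h₃, h₄⟩ := hI.eq_of_comp_sub hp hq h h₂ hl hk hc hcI
      exact hne ⟨h₃.symm, by rw [wrap_of_le h, h₄]⟩
    · exact primal_mul_primal_of_ne hc

theorem triv_mul_pathArc {p : QPath V} (hp : of K p ∉ I) {i l : ℕ} {v : V}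
    (hv : p.verts[i]? = some v) :
    primal I (QPath.triv v) * hI.pathArc p i l = hI.pathArc p i l := by
  have hi : i ≤ p.len := by
    obtain ⟨h, -⟩ := List.getElem?_eq_some_iff.1 hv
    rw [QPath.length_verts] at h
    omega
  rcases Nat.lt_or_ge (p.len + 1) l with hl' | hl'
  · rw [hI.pathArc_of_gt hl', mul_zero]
  rcases Nat.lt_or_ge p.len (i + l) with h | h
  · rw [hI.pathArc_of_lt h hl']
    refine hI.primal_triv_mul_dual (sub_notMem hp (by omega)) ?_
    have := QPath.verts_tgt_sub (p := p) (i := i + l - (p.len + 1)) (l := p.len + 1 - l) (by omega)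
    have e : i + l - (p.len + 1) + (p.len + 1 - l) = i := by omega
    rw [e] at this
    exact Option.some_injective _ (this.symm.trans hv)
  · rw [hI.pathArc_of_le h]
    exact primal_triv_mul_primal (Option.some_injective _ (hv.symm.trans (QPath.verts_src_sub h)))

theorem pathArc_mul_triv {p : QPath V} (hp : of K p ∉ I) {i l : ℕ} {v : V} (hi : i ≤ p.len)
    (hv : p.verts[(i + l) % (p.len + 1)]? = some v) :
    hI.pathArc p i l * primal I (QPath.triv v) = hI.pathArc p i l := by
  rcases Nat.lt_or_ge (p.len + 1) l with hl' | hl'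
  · rw [hI.pathArc_of_gt hl', zero_mul]
  rcases Nat.lt_or_ge p.len (i + l) with h | h
  · rw [hI.pathArc_of_lt h hl']
    rw [wrap_of_lt hi h hl'] at hv
    exact hI.dual_mul_primal_triv (sub_notMem hp (by omega))
      (Option.some_injective _ (hv.symm.trans (QPath.verts_src_sub (by omega))))
  · rw [hI.pathArc_of_le h]
    rw [wrap_of_le h] at hv
    exact primal_mul_primal_triv
      (Option.some_injective _ ((QPath.verts_tgt_sub (by omega)).symm.trans hv))

end IsAlmostGentle

/-! ### The basis of arcs -/

/-- The underlying path of an element of the extended set of maximal paths. -/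
def ExtendedPaths.path (P : ExtendedPaths I) : QPath V := P.1

variable (I) in
/-- The words of the vertices on the paths in the extended set of maximal paths. -/
abbrev pathWords (P : ExtendedPaths I) : List V := P.path.verts

namespace IsAlmostGentle

variable (hI : IsAlmostGentle I)

include hI in
theorem extendedPath_notMem (P : ExtendedPaths I) : of K P.path ∉ I := by
  rcases P.2 with h | ⟨v, -, h⟩
  · exact h.1
  · rw [ExtendedPaths.path, h]
    exact hI.triv_notMem v

theorem isMaximalPath_or (P : ExtendedPaths I) : IsMaximalPath I P.path ∨ P.path.len = 0 := by
  rcases P.2 with h | ⟨v, -, h⟩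
  · exact Or.inl h
  · exact Or.inr (congrArg QPath.len h)

theorem per_eq (x : Pos (pathWords I)) : x.per = x.1.path.len + 1 := QPath.length_verts _

theorem snd_le (x : Pos (pathWords I)) : (x.2 : ℕ) ≤ x.1.path.len := by
  have := x.2.2.trans_eq (QPath.length_verts _)
  omega

theorem verts_getElem?_snd (x : Pos (pathWords I)) : x.1.path.verts[(x.2 : ℕ)]? = some x.label :=
  List.getElem?_eq_getElem x.2.2

theorem exists_pos {P : QPath V} (hP : IsMaximalPath I P) {i : ℕ} {v : V}
    (h : P.verts[i]? = some v) :
    ∃ x : Pos (pathWords I), x.1.path = P ∧ (x.2 : ℕ) = i ∧ x.label = v := by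
  obtain ⟨hi, hv⟩ := List.getElem?_eq_some_iff.1 h
  exact ⟨⟨⟨P, Or.inl hP⟩, ⟨i, hi⟩⟩, rfl, rfl, hv⟩

theorem getElem?_next_iterate (x : Pos (pathWords I)) (l : ℕ) :
    x.1.path.verts[(x.2 + l) % (x.1.path.len + 1)]? = some (Pos.next^[l] x).label := by
  have key : ∀ y : Pos (pathWords I), y.1 = x.1 →
      x.1.path.verts[(y.2 : ℕ)]? = some y.label := fun y hy => hy ▸ verts_getElem?_snd y
  have := key _ (Pos.next_iterate_fst x l)
  have e : ((Pos.next^[l] x).2 : ℕ) = (x.2 + l) % (x.1.path.len + 1) :=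
    (Pos.next_iterate_snd x l).trans (congrArg (_ % ·) (QPath.length_verts _))
  rwa [e] at this

include hI in
theorem isMaximalPath_triv {v : V} (h : ∀ a : QArrow V, a.1 ≠ v ∧ a.2.1 ≠ v) :
    IsMaximalPath I (QPath.triv v) := by
  refine ⟨hI.triv_notMem v, fun u w a => ?_, fun u w a => ?_⟩
  · rw [of_mul_of_ne (p := QPath.arrow a) (q := QPath.triv v) (h ⟨u, w, a⟩).2]
    exact zero_mem _
  · rw [of_mul_of_ne (p := QPath.triv v) (q := QPath.arrow a) (h ⟨u, w, a⟩).1.symm]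
    exact zero_mem _

include hI in
theorem exists_pos_src [∀ u v : V, Finite (u ⟶ v)] (a : QArrow V) :
    ∃ x : Pos (pathWords I), IsMaximalPath I x.1.path ∧ x.1.path.arrows[(x.2 : ℕ)]? = some a ∧
      x.label = a.1 := by
  obtain ⟨p, i, hp, hi, h⟩ := hI.exists_eq_sub (hI.arrow_notMem a.2.2) (by simp)
  rw [QPath.len_arrow] at hi h
  have h₁ := QPath.verts_src_sub hi
  rw [← h] at h₁
  obtain ⟨x, rfl, rfl, hx⟩ := exists_pos hp h₁
  refine ⟨x, hp, ?_, hx⟩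
  have := QPath.head?_arrows_sub hi le_rfl
  rw [← h] at this
  exact this.symm

include hI in
theorem exists_pos_tgt [∀ u v : V, Finite (u ⟶ v)] (a : QArrow V) :
    ∃ x : Pos (pathWords I), IsMaximalPath I x.1.path ∧ 1 ≤ (x.2 : ℕ) ∧
      x.1.path.arrows[(x.2 : ℕ) - 1]? = some a ∧ x.label = a.2.1 := by
  obtain ⟨p, i, hp, hi, h⟩ := hI.exists_eq_sub (hI.arrow_notMem a.2.2) (by simp)
  rw [QPath.len_arrow] at hi h
  have h₁ := QPath.verts_tgt_sub hi
  rw [← h] at h₁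
  obtain ⟨x, rfl, hxi, hx⟩ := exists_pos hp h₁
  refine ⟨x, hp, by omega, ?_, hx⟩
  have := QPath.head?_arrows_sub hi le_rfl
  rw [← h] at this
  rw [hxi]
  exact this.symm

include hI in
-- A vertex that meets an arrow lies on a maximal path through this arrow; the trivial path at an
-- isolated vertex is itself maximal.
theorem label_surjective [∀ u v : V, Finite (u ⟶ v)] (v : V) :
    ∃ x : Pos (pathWords I), x.label = v := by
  by_cases h : ∀ a : QArrow V, a.1 ≠ v ∧ a.2.1 ≠ v
  · obtain ⟨x, -, -, hx⟩ := exists_pos (hI.isMaximalPath_triv h) (i := 0) (v := v) rfl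
    exact ⟨x, hx⟩
  · push Not at h
    obtain ⟨a, ha⟩ := h
    by_cases ha' : a.1 = v
    · obtain ⟨x, -, -, hx⟩ := hI.exists_pos_src a
      exact ⟨x, hx.trans ha'⟩
    · obtain ⟨x, -, -, -, hx⟩ := hI.exists_pos_tgt a
      exact ⟨x, hx.trans (ha ha')⟩

theorem arc_lt_len {x : Pos (pathWords I)} (k : Fin (x.per - 1)) : (k : ℕ) < x.1.path.len := by
  have := k.2
  have := per_eq x
  omega

/-- The nonzero path or the dual functional to which an arc index refers. -/
def arcPath : ArcIndex (pathWords I) → NonzeroPath I ⊕ NonzeroPath I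
  | .inl v => .inl ⟨QPath.triv v, hI.triv_notMem v⟩
  | .inr (.inl v) => .inr ⟨QPath.triv v, hI.triv_notMem v⟩
  | .inr (.inr ⟨x, k⟩) =>
    if h : (x.2 : ℕ) + (k + 1) ≤ x.1.path.len then
      .inl ⟨x.1.path.sub x.2 (k + 1), sub_notMem (hI.extendedPath_notMem x.1) h⟩
    else
      .inr ⟨x.1.path.sub ((x.2 : ℕ) + (k + 1) - (x.1.path.len + 1)) (x.1.path.len + 1 - (k + 1)),
        sub_notMem (hI.extendedPath_notMem x.1) (by
          have := snd_le x
          have := arc_lt_len k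
          omega)⟩

theorem arcPath_of_le {x : Pos (pathWords I)} {k : Fin (x.per - 1)}
    (h : (x.2 : ℕ) + (k + 1) ≤ x.1.path.len) : hI.arcPath (.inr (.inr ⟨x, k⟩)) =
      .inl ⟨x.1.path.sub x.2 (k + 1), sub_notMem (hI.extendedPath_notMem x.1) h⟩ :=
  dif_pos h

theorem arcPath_of_lt {x : Pos (pathWords I)} {k : Fin (x.per - 1)}
    (h : x.1.path.len < (x.2 : ℕ) + (k + 1)) : ∃ h', hI.arcPath (.inr (.inr ⟨x, k⟩)) =
      .inr ⟨x.1.path.sub ((x.2 : ℕ) + (k + 1) - (x.1.path.len + 1)) (x.1.path.len + 1 - (k + 1)), h'⟩ :=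
  ⟨_, dif_neg (by omega)⟩

end IsAlmostGentle
end Arcs

section ArcsBasis

variable {K V : Type*} [Field K] [Quiver V] [Fintype V] {I : TwoSidedIdeal (PathAlgebra K V)}

namespace IsAlmostGentle

variable (hI : IsAlmostGentle I)

theorem isMaximalPath_of_pos {x : Pos (pathWords I)} (h : 1 ≤ x.1.path.len) :
    IsMaximalPath I x.1.path :=
  (isMaximalPath_or x.1).resolve_right (by omega)

theorem pos_ext {x y : Pos (pathWords I)} (h : x.1.path = y.1.path) (h' : (x.2 : ℕ) = y.2) :
    x = y :=
  Pos.ext (Subtype.ext h) h'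

/-- A subpath of positive length determines its maximal path and its starting point by its first
arrow. Its length then gives the length of the arc, either directly or as a complement. -/
theorem arcPath_injective : Function.Injective hI.arcPath := by
  have hne : ∀ (v : V) (x : Pos (pathWords I)) (k : Fin (x.per - 1)) (a : NonzeroPath I),
      (hI.arcPath (.inr (.inr ⟨x, k⟩)) = .inl a ∨ hI.arcPath (.inr (.inr ⟨x, k⟩)) = .inr a) →
        a.1 ≠ QPath.triv v := by
    intro v x k a h hv
    have h₁ := arc_lt_len k
    have h₂ := snd_le x
    have h₃ : a.1.len = 0 := congrArg QPath.len hv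
    rcases Nat.lt_or_ge x.1.path.len ((x.2 : ℕ) + (k + 1)) with h₄ | h₄
    · obtain ⟨h', he⟩ := hI.arcPath_of_lt h₄
      rw [he] at h
      obtain rfl := Sum.inr_injective (h.resolve_left Sum.inr_ne_inl)
      rw [QPath.len_sub (by omega)] at h₃
      omega
    · rw [hI.arcPath_of_le h₄] at h
      obtain rfl := Sum.inl_injective (h.resolve_right Sum.inl_ne_inr)
      rw [QPath.len_sub (by omega)] at h₃
      omega
  have hsub : ∀ (x y : Pos (pathWords I)) (k : Fin (x.per - 1)) (k' : Fin (y.per - 1)),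
      hI.arcPath (.inr (.inr ⟨x, k⟩)) = hI.arcPath (.inr (.inr ⟨y, k'⟩)) →
        x = y ∧ (k : ℕ) = k' := by
    intro x y k k' h
    have hx₁ := arc_lt_len k
    have hx₂ := snd_le x
    have hy₁ := arc_lt_len k'
    have hy₂ := snd_le y
    have hx := isMaximalPath_of_pos (x := x) (by omega)
    have hy := isMaximalPath_of_pos (x := y) (by omega)
    rcases Nat.lt_or_ge x.1.path.len ((x.2 : ℕ) + (k + 1)) with h₁ | h₁ <;>
      rcases Nat.lt_or_ge y.1.path.len ((y.2 : ℕ) + (k' + 1)) with h₂ | h₂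
    · obtain ⟨h₃, h₄⟩ := hI.arcPath_of_lt h₁
      obtain ⟨h₅, h₆⟩ := hI.arcPath_of_lt h₂
      rw [h₄, h₆] at h
      have h := congrArg Subtype.val (Sum.inr_injective h)
      dsimp only at h
      have hl := congrArg QPath.len h
      rw [QPath.len_sub (by omega), QPath.len_sub (by omega)] at hl
      obtain ⟨h₇, h₈⟩ := hI.eq_of_sub_eq hx hy (by omega) (by omega) (by omega) (by omega)
        (congrArg (fun q => q.arrows.head?) h)
      have h₉ := congrArg QPath.len h₇
      exact ⟨pos_ext h₇ (by omega), by omega⟩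
    · obtain ⟨h₃, h₄⟩ := hI.arcPath_of_lt h₁
      rw [h₄, hI.arcPath_of_le h₂] at h
      exact absurd h Sum.inr_ne_inl
    · obtain ⟨h₃, h₄⟩ := hI.arcPath_of_lt h₂
      rw [h₄, hI.arcPath_of_le h₁] at h
      exact absurd h Sum.inl_ne_inr
    · rw [hI.arcPath_of_le h₁, hI.arcPath_of_le h₂] at h
      have h := congrArg Subtype.val (Sum.inl_injective h)
      dsimp only at h
      have hl := congrArg QPath.len h
      rw [QPath.len_sub (by omega), QPath.len_sub (by omega)] at hl
      obtain ⟨h₇, h₈⟩ := hI.eq_of_sub_eq hx hy (by omega) (by omega) (by omega) (by omega)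
        (congrArg (fun q => q.arrows.head?) h)
      exact ⟨pos_ext h₇ h₈, by omega⟩
  rintro (u | u | ⟨x, k⟩) (v | v | ⟨y, k'⟩) h
  · exact congrArg Sum.inl (congrArg Sigma.fst (congrArg Subtype.val (Sum.inl_injective h)))
  · exact absurd h Sum.inl_ne_inr
  · exact absurd rfl (hne u y k' _ (Or.inl h.symm))
  · exact absurd h Sum.inr_ne_inl
  · exact congrArg (fun u => Sum.inr (Sum.inl u))
      (congrArg Sigma.fst (congrArg Subtype.val (Sum.inr_injective h)))
  · exact absurd rfl (hne u y k' _ (Or.inr h.symm))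
  · exact absurd rfl (hne v x k _ (Or.inl h))
  · exact absurd rfl (hne v x k _ (Or.inr h))
  · obtain ⟨rfl, h'⟩ := hsub x y k k' h
    rw [Fin.ext h']

theorem arcPath_surjective [∀ u v : V, Finite (u ⟶ v)] : Function.Surjective hI.arcPath := by
  -- The Boolean selects the starting point of the arc: the source of `q` if the arc is `q` itself,
  -- the target of `q` if it is the dual functional.
  have hsub : ∀ q : NonzeroPath I, q.1.arrows ≠ [] → ∀ s : Bool,
      ∃ (x : Pos (pathWords I)) (i : ℕ), IsMaximalPath I x.1.path ∧ i + q.1.len ≤ x.1.path.len ∧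
        q.1 = x.1.path.sub i q.1.len ∧ (x.2 : ℕ) = if s then i else i + q.1.len := by
    intro q hq s
    obtain ⟨p, i, hp, hi, h⟩ := hI.exists_eq_sub q.2 hq
    cases s
    · obtain ⟨x, rfl, hx, -⟩ := exists_pos hp (QPath.verts_tgt_sub hi)
      exact ⟨x, i, hp, hi, h, hx⟩
    · obtain ⟨x, rfl, hx, -⟩ := exists_pos hp (QPath.verts_src_sub hi)
      exact ⟨x, i, hp, hi, h, hx⟩
  rintro (q | q)
  · by_cases hq : q.1.arrows = []
    · exact ⟨.inl q.1.src, congrArg Sum.inl (Subtype.ext (QPath.eq_triv_of_arrows _ hq).symm)⟩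
    · have hl : q.1.len ≠ 0 := by
        rw [← QPath.length_arrows]
        exact fun h => hq (List.eq_nil_of_length_eq_zero h)
      obtain ⟨x, i, hx, hi, h, hxi⟩ := hsub q hq true
      have hper := per_eq x
      rw [if_pos rfl] at hxi
      refine ⟨.inr (.inr ⟨x, ⟨q.1.len - 1, by omega⟩⟩), ?_⟩
      have e : q.1.len - 1 + 1 = q.1.len := by omega
      rw [hI.arcPath_of_le (by simp only; omega)]
      refine congrArg Sum.inl (Subtype.ext ?_)
      simp only [e, hxi]
      exact h.symm
  · by_cases hq : q.1.arrows = []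
    · exact ⟨.inr (.inl q.1.src),
        congrArg Sum.inr (Subtype.ext (QPath.eq_triv_of_arrows _ hq).symm)⟩
    · have hl : q.1.len ≠ 0 := by
        rw [← QPath.length_arrows]
        exact fun h => hq (List.eq_nil_of_length_eq_zero h)
      obtain ⟨x, i, hx, hi, h, hxi⟩ := hsub q hq false
      have hper := per_eq x
      simp only [Bool.false_eq_true, if_false] at hxi
      -- The arc complementary to `q` has length `len + 1 - q.len`, and the index is one less than
      -- the length.
      refine ⟨.inr (.inr ⟨x, ⟨x.1.path.len - q.1.len, by omega⟩⟩), ?_⟩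
      obtain ⟨h', he⟩ := hI.arcPath_of_lt (x := x) (k := ⟨x.1.path.len - q.1.len, by omega⟩)
        (by simp only; omega)
      rw [he]
      refine congrArg Sum.inr (Subtype.ext ?_)
      have e₁ : (x.2 : ℕ) + (x.1.path.len - q.1.len + 1) - (x.1.path.len + 1) = i := by omega
      have e₂ : x.1.path.len + 1 - (x.1.path.len - q.1.len + 1) = q.1.len := by omega
      simp only [e₁, e₂]
      exact h.symm

/-- The basis of the trivial extension, indexed by arcs. -/
def arcIndexBasis [∀ u v : V, Finite (u ⟶ v)] :
    Basis (ArcIndex (pathWords I)) K (TrivialExtension K (QuotientAlgebra I)) :=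
  hI.trivialExtensionBasis.reindex
    (Equiv.ofBijective hI.arcPath ⟨hI.arcPath_injective, hI.arcPath_surjective⟩).symm

theorem arcIndexBasis_apply [∀ u v : V, Finite (u ⟶ v)] (i : ArcIndex (pathWords I)) :
    hI.arcIndexBasis i = hI.trivialExtensionBasis (hI.arcPath i) := by
  rw [arcIndexBasis, Basis.reindex_apply]
  rfl

theorem arcIndexBasis_inl [∀ u v : V, Finite (u ⟶ v)] (v : V) :
    hI.arcIndexBasis (.inl v) = primal I (QPath.triv v) :=
  (hI.arcIndexBasis_apply _).trans (hI.trivialExtensionBasis_inl _)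

theorem arcIndexBasis_inr_inl [∀ u v : V, Finite (u ⟶ v)] (v : V) :
    hI.arcIndexBasis (.inr (.inl v)) = hI.dual (QPath.triv v) :=
  (hI.arcIndexBasis_apply _).trans (hI.trivialExtensionBasis_inr _)

theorem arcIndexBasis_arc [∀ u v : V, Finite (u ⟶ v)] (x : Pos (pathWords I))
    (k : Fin (x.per - 1)) :
    hI.arcIndexBasis (.inr (.inr ⟨x, k⟩)) = hI.pathArc x.1.path x.2 (k + 1) := by
  rw [arcIndexBasis_apply]
  have hk := arc_lt_len k
  rcases Nat.lt_or_ge x.1.path.len ((x.2 : ℕ) + (k + 1)) with h | h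
  · obtain ⟨h', he⟩ := hI.arcPath_of_lt h
    rw [he, hI.trivialExtensionBasis_inr, hI.pathArc_of_lt h (by omega)]
  · rw [hI.arcPath_of_le h, hI.trivialExtensionBasis_inl, hI.pathArc_of_le h]

/-- The presentation of the trivial extension by the cyclic words of the extended paths. -/
def arcBasis [∀ u v : V, Finite (u ⟶ v)] :
    ArcBasis K (TrivialExtension K (QuotientAlgebra I)) (pathWords I) where
  basis := hI.arcIndexBasis
  arc x l := hI.pathArc x.1.path x.2 l
  arc_lt x i := (hI.arcIndexBasis_arc x i).symm
  arc_per x := by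
    rw [per_eq, hI.pathArc_full (verts_getElem?_snd x), arcIndexBasis_inr_inl]
  arc_gt x l h := hI.pathArc_of_gt (by rwa [per_eq] at h)
  arc_mul_arc x l k hl hk := by
    have h := hI.pathArc_mul_pathArc (hI.extendedPath_notMem x.1) (snd_le x) hl hk
    have e : ((Pos.next^[l] x).2 : ℕ) = (x.2 + l) % (x.1.path.len + 1) :=
      (Pos.next_iterate_snd x l).trans (congrArg (_ % ·) (QPath.length_verts _))
    rw [e, Pos.next_iterate_fst]
    exact h
  arc_mul_arc_of_ne x y l k hl hk h := by
    refine hI.pathArc_mul_pathArc_of_ne (isMaximalPath_or x.1) (isMaximalPath_or y.1) (snd_le x)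
      (snd_le y) hl hk fun h' => h (Pos.eq_iterate_iff.2 ⟨Subtype.ext h'.1, ?_⟩)
    exact h'.2.trans (congrArg (_ % ·) (QPath.length_verts _).symm)
  e_mul_e v := by
    rw [arcIndexBasis_inl]
    exact primal_triv_mul_primal (p := QPath.triv v) rfl
  e_mul_e_of_ne u v h := by
    rw [arcIndexBasis_inl, arcIndexBasis_inl]
    exact primal_mul_primal_of_ne (p := QPath.triv u) (q := QPath.triv v) h
  sum_e := by
    simp only [arcIndexBasis_inl]
    exact sum_primal_triv
  e_mul_arc x l _ := by
    rw [arcIndexBasis_inl]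
    exact hI.triv_mul_pathArc (hI.extendedPath_notMem x.1) (verts_getElem?_snd x)
  arc_mul_e x l _ := by
    rw [arcIndexBasis_inl]
    exact hI.pathArc_mul_triv (hI.extendedPath_notMem x.1) (snd_le x) (getElem?_next_iterate x l)
  label_surjective := hI.label_surjective

/-! ### Truncated vertices -/

theorem exists_arrow_src {x : Pos (pathWords I)} (h : (x.2 : ℕ) < x.1.path.len) :
    ∃ a : QArrow V, x.1.path.arrows[(x.2 : ℕ)]? = some a ∧ a.1 = x.label := by
  have h₁ := QPath.head?_arrows_sub (p := x.1.path) (i := x.2) (l := 1) (by omega) le_rfl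
  have h₂ := QPath.verts_src_sub (p := x.1.path) (i := x.2) (l := 1) (by omega)
  have h₃ : (x.2 : ℕ) < x.1.path.arrows.length := by rwa [QPath.length_arrows]
  refine ⟨x.1.path.arrows[(x.2 : ℕ)], List.getElem?_eq_getElem h₃, ?_⟩
  rw [List.getElem?_eq_getElem h₃] at h₁
  obtain ⟨l, hl⟩ := List.head?_eq_some_iff.1 h₁
  rw [← QPath.src_eq_of_arrows hl]
  exact Option.some_injective _ (h₂.symm.trans (verts_getElem?_snd x))

theorem exists_arrow_tgt {x : Pos (pathWords I)} (h : 1 ≤ (x.2 : ℕ)) :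
    ∃ a : QArrow V, x.1.path.arrows[(x.2 : ℕ) - 1]? = some a ∧ a.2.1 = x.label := by
  have hx := snd_le x
  have h₁ := QPath.getLast?_arrows_sub (p := x.1.path) (i := x.2 - 1) (l := 1) (by omega) le_rfl
  have h₂ := QPath.verts_tgt_sub (p := x.1.path) (i := x.2 - 1) (l := 1) (by omega)
  have h₃ : (x.2 : ℕ) - 1 < x.1.path.arrows.length := by
    rw [QPath.length_arrows]
    omega
  refine ⟨x.1.path.arrows[(x.2 : ℕ) - 1], List.getElem?_eq_getElem h₃, ?_⟩
  rw [Nat.add_sub_cancel, List.getElem?_eq_getElem h₃] at h₁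
  obtain ⟨l, hl⟩ := List.getLast?_eq_some_iff.1 h₁
  rw [← QPath.tgt_eq_of_arrows hl]
  rw [Nat.sub_add_cancel h] at h₂
  exact Option.some_injective _ (h₂.symm.trans (verts_getElem?_snd x))

include hI in
theorem pos_eq_of_arrow {x y : Pos (pathWords I)} (hx : 1 < x.per) (hy : 1 < y.per)
    {i j : ℕ} {a : QArrow V} (hi : x.1.path.arrows[i]? = some a)
    (hj : y.1.path.arrows[j]? = some a) : x.1.path = y.1.path ∧ i = j := by
  rw [per_eq] at hx hy
  exact hI.eq_of_getElem? (isMaximalPath_of_pos (by omega)) (isMaximalPath_of_pos (by omega)) hi hj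

include hI in
-- Under each of the three conditions, every occurrence of `v` in a longer word is adjacent, on a
-- fixed side, to one fixed arrow, and an arrow has only one place. An isolated vertex does not
-- occur in longer words at all.
theorem subsingleton_of_isMaximalPath_or_isTruncated {v : V}
    (h : IsMaximalPath I (QPath.triv v) ∨ IsTruncated I v) {x y : Pos (pathWords I)}
    (hx : 1 < x.per) (hy : 1 < y.per) (hxv : x.label = v) (hyv : y.label = v) : x = y := by
  have hout : ∀ z : Pos (pathWords I), z.label = v → (z.2 : ℕ) < z.1.path.len →
      ∃ b : Σ w : V, v ⟶ w, z.1.path.arrows[(z.2 : ℕ)]? = some ⟨v, b⟩ := by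
    rintro z rfl hz
    obtain ⟨⟨u, b⟩, ha, hav⟩ := exists_arrow_src hz
    dsimp only at hav
    subst hav
    exact ⟨b, ha⟩
  have hin : ∀ z : Pos (pathWords I), z.label = v → 1 ≤ (z.2 : ℕ) →
      ∃ b : Σ u : V, u ⟶ v, z.1.path.arrows[(z.2 : ℕ) - 1]? = some ⟨b.1, v, b.2⟩ := by
    rintro z rfl hz
    obtain ⟨⟨u, w, b⟩, ha, hav⟩ := exists_arrow_tgt hz
    dsimp only at hav
    subst hav
    exact ⟨⟨u, b⟩, ha⟩
  have heq_out : ∀ b : Σ w : V, v ⟶ w, x.1.path.arrows[(x.2 : ℕ)]? = some ⟨v, b⟩ →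
      y.1.path.arrows[(y.2 : ℕ)]? = some ⟨v, b⟩ → x = y := by
    intro b h₁ h₂
    obtain ⟨h₃, h₄⟩ := hI.pos_eq_of_arrow hx hy h₁ h₂
    exact pos_ext h₃ h₄
  have heq_in : ∀ b : Σ u : V, u ⟶ v, 1 ≤ (x.2 : ℕ) → 1 ≤ (y.2 : ℕ) →
      x.1.path.arrows[(x.2 : ℕ) - 1]? = some ⟨b.1, v, b.2⟩ →
      y.1.path.arrows[(y.2 : ℕ) - 1]? = some ⟨b.1, v, b.2⟩ → x = y := by
    intro b hx₁ hy₁ h₁ h₂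
    obtain ⟨h₃, h₄⟩ := hI.pos_eq_of_arrow hx hy h₁ h₂
    exact pos_ext h₃ (by omega)
  have hside : ∀ z : Pos (pathWords I), 1 < z.per → (z.2 : ℕ) < z.1.path.len ∨ 1 ≤ (z.2 : ℕ) := by
    intro z hz
    rw [per_eq] at hz
    omega
  rcases h with h | ⟨⟨b, hb⟩, hE⟩ | ⟨⟨a, ha⟩, hE⟩ | ⟨a, b, ha, hb, hab⟩
  · exfalso
    rcases hside x hx with hs | hs
    · obtain ⟨b, -⟩ := hout x hxv hs
      have := h.2.2 _ _ b.2
      have hmul : of K (QPath.triv v) * of K (QPath.arrow b.2) = of K (QPath.arrow b.2) :=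
        (of_mul_of_comp _ _ rfl).trans (congrArg (of K) (QPath.triv_comp (QPath.arrow b.2) v rfl))
      rw [hmul] at this
      exact hI.arrow_notMem b.2 this
    · obtain ⟨b, -⟩ := hin x hxv hs
      have := h.2.1 _ _ b.2
      have hmul : of K (QPath.arrow b.2) * of K (QPath.triv v) = of K (QPath.arrow b.2) :=
        (of_mul_of_comp _ _ rfl).trans (congrArg (of K) (QPath.comp_triv (QPath.arrow b.2) v rfl))
      rw [hmul] at this
      exact hI.arrow_notMem b.2 this
  · have hs : ∀ z : Pos (pathWords I), 1 < z.per → z.label = v →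
        z.1.path.arrows[(z.2 : ℕ)]? = some ⟨v, b⟩ := by
      intro z hz hzv
      rcases hside z hz with hs | hs
      · obtain ⟨b', h'⟩ := hout z hzv hs
        rwa [hb b'] at h'
      · exact hE.elim (hin z hzv hs).choose
    exact heq_out b (hs x hx hxv) (hs y hy hyv)
  · have hs : ∀ z : Pos (pathWords I), 1 < z.per → z.label = v → 1 ≤ (z.2 : ℕ) ∧
        z.1.path.arrows[(z.2 : ℕ) - 1]? = some ⟨a.1, v, a.2⟩ := by
      intro z hz hzv
      rcases hside z hz with hs | hs
      · exact hE.elim (hout z hzv hs).choose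
      · obtain ⟨a', h'⟩ := hin z hzv hs
        rw [ha a'] at h'
        exact ⟨hs, h'⟩
    exact heq_in a (hs x hx hxv).1 (hs y hy hyv).1 (hs x hx hxv).2 (hs y hy hyv).2
  · have hs : ∀ z : Pos (pathWords I), 1 < z.per → z.label = v → 1 ≤ (z.2 : ℕ) ∧
        z.1.path.arrows[(z.2 : ℕ) - 1]? = some ⟨a.1, v, a.2⟩ := by
      intro z hz hzv
      rcases Nat.eq_zero_or_pos (z.2 : ℕ) with h0 | h0
      · obtain ⟨b', h'⟩ := hout z hzv (by rw [per_eq] at hz; omega)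
        rw [hb b', h0, ← List.head?_eq_getElem?] at h'
        rw [per_eq] at hz
        -- An occurrence at the beginning of a maximal path is impossible, since the path could be
        -- prolonged by `a` in front of `b`.
        exact absurd ⟨rfl, hab⟩ (hI.not_link_head (isMaximalPath_of_pos (by omega)) h'
          ⟨a.1, v, a.2⟩)
      · obtain ⟨a', h'⟩ := hin z hzv h0
        rw [ha a'] at h'
        exact ⟨h0, h'⟩
    exact heq_in a (hs x hx hxv).1 (hs y hy hyv).1 (hs x hx hxv).2 (hs y hy hyv).2

include hI in
-- Every arrow at `v` produces an occurrence of `v` in a longer word. If there is at most one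
-- occurrence, then at most one arrow enters and at most one leaves `v`; if both exist, they are
-- consecutive on a nonzero path.
theorem isMaximalPath_or_isTruncated_of_subsingleton [∀ u v : V, Finite (u ⟶ v)] {v : V}
    (h : ∀ x y : Pos (pathWords I), 1 < x.per → 1 < y.per → x.label = v → y.label = v → x = y) :
    IsMaximalPath I (QPath.triv v) ∨ IsTruncated I v := by
  have hper : ∀ (x : Pos (pathWords I)) (i : ℕ) (a : QArrow V), x.1.path.arrows[i]? = some a →
      1 < x.per := by
    intro x i a ha
    obtain ⟨hi, -⟩ := List.getElem?_eq_some_iff.1 ha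
    rw [QPath.length_arrows] at hi
    rw [per_eq]
    omega
  have hout : ∀ b b' : Σ w : V, v ⟶ w, b' = b := by
    intro b b'
    obtain ⟨x, -, hx, hxv⟩ := hI.exists_pos_src ⟨v, b⟩
    obtain ⟨y, -, hy, hyv⟩ := hI.exists_pos_src ⟨v, b'⟩
    obtain rfl := h x y (hper _ _ _ hx) (hper _ _ _ hy) hxv hyv
    have := Option.some_injective _ (hx.symm.trans hy)
    exact (eq_of_heq (Sigma.mk.inj_iff.1 this).2).symm
  have hin : ∀ b b' : Σ u : V, u ⟶ v, b' = b := by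
    rintro ⟨u, b⟩ ⟨u', b'⟩
    obtain ⟨x, -, -, hx, hxv⟩ := hI.exists_pos_tgt ⟨u, v, b⟩
    obtain ⟨y, -, -, hy, hyv⟩ := hI.exists_pos_tgt ⟨u', v, b'⟩
    obtain rfl := h x y (hper _ _ _ hx) (hper _ _ _ hy) hxv hyv
    cases Option.some_injective _ (hx.symm.trans hy)
    rfl
  by_cases hO : Nonempty (Σ w : V, v ⟶ w) <;> by_cases hN : Nonempty (Σ u : V, u ⟶ v)
  · obtain ⟨b⟩ := hO
    obtain ⟨a⟩ := hN
    refine Or.inr (Or.inr (Or.inr ⟨a, b, hin a, hout b, ?_⟩))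
    obtain ⟨x, hxm, hx1, hx, hxv⟩ := hI.exists_pos_tgt ⟨a.1, v, a.2⟩
    obtain ⟨y, -, hy, hyv⟩ := hI.exists_pos_src ⟨v, b⟩
    obtain rfl := h x y (hper _ _ _ hx) (hper _ _ _ hy) hxv hyv
    obtain ⟨hi, hx'⟩ := List.getElem?_eq_some_iff.1 hx
    obtain ⟨hj, hy'⟩ := List.getElem?_eq_some_iff.1 hy
    have := List.isChain_iff_getElem.1 (isChain_of_notMem hxm.1) (x.2 - 1) (by omega)
    simp only [Nat.sub_add_cancel hx1] at this
    rw [hx', hy'] at this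
    exact this.2
  · obtain ⟨b⟩ := hO
    exact Or.inr (Or.inl ⟨⟨b, hout b⟩, not_nonempty_iff.1 hN⟩)
  · obtain ⟨a⟩ := hN
    exact Or.inr (Or.inr (Or.inl ⟨⟨a, hin a⟩, not_nonempty_iff.1 hO⟩))
  · refine Or.inl (hI.isMaximalPath_triv fun a => ⟨?_, ?_⟩)
    · rintro rfl
      exact hO ⟨a.2⟩
    · rintro rfl
      exact hN ⟨⟨a.1, a.2.2⟩⟩

include hI in
-- This is where the conditions for adding trivial paths enter: together with isolation they
-- characterise the vertices with at most one occurrence in longer words.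
theorem isReduced_pathWords [∀ u v : V, Finite (u ⟶ v)] : IsReduced (pathWords I) := by
  intro v
  have := hI.finite
  have hpath : ∀ x : Pos (pathWords I), x.per = 1 → x.label = v →
      x.1.path = QPath.triv v ∧ (x.2 : ℕ) = 0 := by
    intro x hx hv
    rw [per_eq] at hx
    have h0 := snd_le x
    have h₁ : x.1.path = QPath.triv x.1.path.src := QPath.eq_triv_of_arrows _
      (List.eq_nil_of_length_eq_zero (by rw [QPath.length_arrows]; omega))
    have h₂ := verts_getElem?_snd x
    have h₃ : (x.2 : ℕ) = 0 := by omega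
    rw [h₃, QPath.verts_eq] at h₂
    have h₄ : x.1.path.src = v := (Option.some_injective _ h₂).trans hv
    exact ⟨h₁.trans (congrArg QPath.triv h₄), h₃⟩
  -- A word of length one at `v` comes from the trivial path, which is counted only once, so the
  -- number of these words is zero or one.
  have hsub : Subsingleton {x : Pos (pathWords I) // x.per = 1 ∧ x.label = v} := by
    refine ⟨fun x y => Subtype.ext ?_⟩
    obtain ⟨h₁, h₂⟩ := hpath x.1 x.2.1 x.2.2
    obtain ⟨h₃, h₄⟩ := hpath y.1 y.2.1 y.2.2
    exact pos_ext (h₁.trans h₃.symm) (h₂.trans h₄.symm)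
  split_ifs with h <;> rw [Finite.card_le_one_iff_subsingleton] at h
  · rw [Nat.card_eq_one_iff_unique]
    refine ⟨hsub, ?_⟩
    have hP := hI.isMaximalPath_or_isTruncated_of_subsingleton (v := v) fun x y hx hy hxv hyv =>
      congrArg Subtype.val (h.elim ⟨x, hx, hxv⟩ ⟨y, hy, hyv⟩)
    let P : ExtendedPaths I := ⟨QPath.triv v, hP.imp_right fun h => ⟨v, h, rfl⟩⟩
    exact ⟨⟨⟨P, ⟨0, Nat.one_pos⟩⟩, rfl, rfl⟩⟩
  · rw [Finite.card_eq_zero_iff]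
    refine ⟨fun x => h ⟨fun y z => Subtype.ext ?_⟩⟩
    refine hI.subsingleton_of_isMaximalPath_or_isTruncated (v := v) ?_ y.2.1 z.2.1 y.2.2 z.2.2
    have h₁ := (hpath x.1 x.2.1 x.2.2).1
    rcases x.1.1.2 with h₂ | ⟨u, hu, h₂⟩
    · left
      rw [← h₁]
      exact h₂
    · right
      have h₃ : QPath.triv v = QPath.triv u := h₁.symm.trans h₂
      have h₄ : v = u := congrArg Sigma.fst h₃
      rwa [h₄]

end IsAlmostGentle
end ArcsBasis

end AlmostGentle

end

/-! ### The equivalence -/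

theorem theorem7 {K V W : Type*} [Field K]
    [Quiver V] [Fintype V] [∀ u v : V, Finite (u ⟶ v)]
    [Quiver W] [Fintype W] [∀ u v : W, Finite (u ⟶ v)]
    (I : TwoSidedIdeal (AlmostGentle.PathAlgebra K V)) (hI : AlmostGentle.IsAlmostGentle I)
    (J : TwoSidedIdeal (AlmostGentle.PathAlgebra K W)) (hJ : AlmostGentle.IsAlmostGentle J) :
    Nonempty (AlmostGentle.OrientedHypergraph.Iso
        (AlmostGentle.hypergraph hI) (AlmostGentle.hypergraph hJ)) ↔
      Nonempty (AlmostGentle.TrivialExtension K (AlmostGentle.QuotientAlgebra I) ≃ₐ[K]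
        AlmostGentle.TrivialExtension K (AlmostGentle.QuotientAlgebra J)) := by
  constructor
  · rintro ⟨Φ⟩
    obtain ⟨p, h₁, h₂, h₃⟩ := AlmostGentle.Pos.exists_posEquiv
      (c := AlmostGentle.pathWords I) (c' := AlmostGentle.pathWords J) Φ.edge Φ.vert Φ.map_order
    exact hI.arcBasis.nonempty_algEquiv hJ.arcBasis p Φ.edge h₁ h₂ h₃
  · rintro ⟨φ⟩
    have := hI.finite
    have := hJ.finite
    -- Transport along `φ` places both presentations on the same algebra, where they share the
    -- characters.
    obtain ⟨ε, hε⟩ := (hI.arcBasis.map φ).exists_equiv_count_eq hJ.arcBasis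
    obtain ⟨v, hv⟩ := AlmostGentle.Pos.exists_equiv_of_fullCount_eq
      (c := AlmostGentle.pathWords I) (c' := AlmostGentle.pathWords J) ε
      (fun P => Quiver.Path.vertices_ne_nil _) (fun P => Quiver.Path.vertices_ne_nil _)
      (AlmostGentle.Pos.fullCount_eq_of_count_eq ε hI.isReduced_pathWords
        hJ.isReduced_pathWords hε)
    exact ⟨⟨v, ε, AlmostGentle.OrientedHypergraph.map_edge_of_map_order
      (AlmostGentle.hypergraph hI) (AlmostGentle.hypergraph hJ) v ε hv, hv⟩⟩
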